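/- Noisy Lipschitz bandits with Gaussian noise. Let $(X,L)$ be a nonempty metric space of diameter at most $1$ and let $\mu : X\to[0,1]$ satisfy $|\mu(x)-\mu(y)|\le L(x,y)$ for all $x,y\in X$; put $\mu^*=\sup_{x\in X}\mu(x)$. In each round the algorithm plays a strategy $x\in X$ and observes the reward $\mu(x)+\eta$, where $\eta$ is a fresh independent sample from $\mathcal N(0,\sigma^2)$, $\sigma>0$. The algorithm knows $X$ and $\sigma$, but not $\mu$; it has access to the metric only through a covering oracle, which takes a finite collection of open balls and either declares that they cover $X$ or outputs a point of $X$ that is not covered. The regret $R_{\mathcal A}(t)$ of an algorithm $\mathcal A$ is $t\mu^*$ minus the expected total reward that $\mathcal A$ collects in the first $t$ rounds. For $C>0$, the $C$-zooming dimension of $(L,X,\mu)$ is the smallest $d\ge 0$ such that for every $r\in(0,1]$ the set $\{x\in X:\ r/2<\mu^*-\mu(x)\le r\}$ can be covered by at most $C\,r^{-d}$ sets of diameter at most $r/8$. Theorem. There is an absolute constant $K>0$ such that for every nonempty set $X$ and every $\sigma>0$ there is an algorithm $\mathcal A$, which makes one query to the covering oracle per round and depends neither on $L$, $\mu$, $C$,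 $d$ nor on the number of rounds, with the following property. For every metric $L$ on $X$ of diameter at most $1$, every covering oracle for $(X,L)$ and every payoff function $\mu$ as above, all rewards are integrable, and for every $C>0$ for which the $C$-zooming dimension $d$ of $(L,X,\mu)$ is finite, $$R_{\mathcal A}(t)\ \le\ \max\{1,\sigma\}\cdot (K\,C\log t)^{1/(2+d)}\; t^{\,1-1/(2+d)}\qquad\text{for all integers } t\ge 2 .$$ In particular, for $\sigma\ge 1$ this is the regret bound $O(C\log t)^{1/(2+d)}\,t^{1-1/(2+d)}$ multiplied by $\sigma$; and for each fixed $\sigma>0$ it is $\sigma$ times that bound up to a constant factor depending only on $\sigma$. -/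

import Mathlib

open MeasureTheory ProbabilityTheory Metric

namespace LipschitzBandit

/-- The maximal expected reward `μ* = sup_x μ(x)`. -/
noncomputable def maxReward {X : Type*} (μ : X → ℝ) : ℝ := ⨆ x, μ x

/-- A payoff function `μ : X → [0,1]` that is 1-Lipschitz for the similarity function `dist`. -/
structure IsPayoff {X : Type*} [MetricSpace X] (μ : X → ℝ) : Prop where
  mem_Icc : ∀ x, μ x ∈ Set.Icc (0 : ℝ) 1
  lipschitz : ∀ x y, |μ x - μ y| ≤ dist x y

/-- The near-optimal layer `X_r = {x : r/2 < μ* - μ(x) ≤ r}`. -/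
def layer {X : Type*} (μ : X → ℝ) (r : ℝ) : Set X :=
  {x | r / 2 < maxReward μ - μ x ∧ maxReward μ - μ x ≤ r}

/-- `A` can be covered by (at most) `N` sets of diameter at most `δ`. -/
def CoverableBy {X : Type*} [MetricSpace X] (A : Set X) (N δ : ℝ) : Prop :=
  ∃ F : Finset (Set X), (F.card : ℝ) ≤ N ∧
    (∀ S ∈ F, ∀ x ∈ S, ∀ y ∈ S, dist x y ≤ δ) ∧ ∀ x ∈ A, ∃ S ∈ F, x ∈ S

/-- `d` is the `C`-zooming dimension of the instance: the smallest `d ≥ 0` such that for every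
`r ∈ (0,1]` the layer `X_r` can be covered by `C r^{-d}` sets of diameter at most `r/8`. -/
def IsZoomingDim {X : Type*} [MetricSpace X] (μ : X → ℝ) (C d : ℝ) : Prop :=
  IsLeast {d' : ℝ | 0 ≤ d' ∧ ∀ r ∈ Set.Ioc (0 : ℝ) 1,
    CoverableBy (layer μ r) (C * r ^ (-d')) (r / 8)} d

/-- A covering oracle for the metric space: it takes a finite collection of open balls, given by
centres and radii, and either declares (`none`) that they cover the space, or outputs a point
that is not covered. -/
structure IsCoveringOracle {X : Type*} [MetricSpace X] (O : List (X × ℝ) → Option X) : Prop where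
  covered : ∀ B, O B = none → ∀ x, ∃ b ∈ B, x ∈ ball b.1 b.2
  uncovered : ∀ B x, O B = some x → ∀ b ∈ B, x ∉ ball b.1 b.2

/-- What the algorithm sees in one round: the reply of the oracle, the strategy played, and the
reward obtained. -/
structure Round (X : Type*) where
  reply : Option X
  strategy : X
  reward : ℝ

/-- A (deterministic) bandit algorithm with access to a covering oracle: in each round, from the
list of the past rounds (most recent first) it chooses one query to the oracle, and from that
list and the oracle's reply it chooses the strategy to play. -/
structure Algorithm (X : Type*) where
  query : List (Round X) → List (X × ℝ)
  play : List (Round X) → Option X → X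

namespace Algorithm

variable {X : Type*} (A : Algorithm X) (O : List (X × ℝ) → Option X) (μ : X → ℝ)

/-- The list of the first `t` rounds (most recent first), when the noise in round `s`
(counted from `0`) is `ξ s`: playing `x` in round `s` yields the reward `μ x + ξ s`. -/
def history (ξ : ℕ → ℝ) : ℕ → List (Round X)
  | 0 => []
  | t + 1 =>
    let h := history ξ t
    let a := O (A.query h)
    let x := A.play h a
    ⟨a, x, μ x + ξ t⟩ :: h

/-- The strategy played in round `s`. -/
def strategyAt (ξ : ℕ → ℝ) (s : ℕ) : X :=
  A.play (A.history O μ ξ s) (O (A.query (A.history O μ ξ s)))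

/-- The reward obtained in round `s`. -/
def rewardAt (ξ : ℕ → ℝ) (s : ℕ) : ℝ :=
  μ (A.strategyAt O μ ξ s) + ξ s

/-- The regret after `t` rounds: `t μ*` minus the expected total payoff of the first `t` rounds,
when the noise sequence is `η` under the probability measure `P`. -/
noncomputable def regret {Ω : Type*} [MeasurableSpace Ω] (P : Measure Ω) (η : ℕ → Ω → ℝ)
    (t : ℕ) : ℝ :=
  t * maxReward μ - ∫ ω, ∑ s ∈ Finset.range t, A.rewardAt O μ (fun k => η k ω) s ∂P

end Algorithm

end LipschitzBandit

/-! The algorithm keeps around each arm played `n` times a ball of radius `√(b/n)`. It plays a point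
outside all balls if there is one, otherwise the active arm of highest index. Suppose that all
empirical means are within their radii. By the Lipschitz condition the highest index then dominates
`μ*`, so an arm of loss `Δ` is played `O(b/Δ²)` times and its ball never shrinks below a constant
multiple of `Δ`. Hence the arms of a layer `X_r` are `r/8`-separated, a covering of `X_r` bounds
their number, and the layer costs `O(C b r^{-2-d})` rounds (`visits_mul_gap_sq_le`,
`dist_gt_of_layer`, `card_layer_le`). Summing over dyadic `r` above a scale `Y`, and charging `Y/2`
per round below it, gives the rate for `Y ≈ (C log t / t)^{1/(2+d)}`.

The horizon is removed by restarting at the times `T = 2^2^k`, with `b` proportional to `log T²` in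
the phase `[T, T²)`. For round `t` only the current and the previous phase need analysis, because
fewer than `2√t` rounds or so precede them.

Arms are chosen adaptively, so the means are controlled by an exponential martingale with
predictable selection (`lintegral_tiltProd`), Markov's inequality and a union bound over rounds
instead of arms. Since `X`, `μ` and the oracle carry no measurability, the algorithm sees rewards
rounded to a grid: its history takes countably many values, and every function of it is measurable.
-/

namespace LipschitzBandit

/-! ### Pathwise analysis of the zooming rule on the clean event -/

open Classical in
/-- The number of rounds in `[T, s)` in which the arm `z` is played. -/
noncomputable def visits {X : Type*} (x : ℕ → X) (T s : ℕ) (z : X) : ℕ :=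
  ((Finset.Ico T s).filter (fun v => x v = z)).card

/-- The confidence radius of an arm that has been played `n` times. -/
noncomputable def radius (b : ℝ) (n : ℕ) : ℝ := √(b / n)

/-- The loss `μ* - μ(z)` of an arm. -/
noncomputable def gap {X : Type*} (μ : X → ℝ) (z : X) : ℝ := maxReward μ - μ z

theorem mem_layer {X : Type*} {μ : X → ℝ} {r : ℝ} {z : X} :
    z ∈ layer μ r ↔ r / 2 < gap μ z ∧ gap μ z ≤ r := Iff.rfl

theorem visits_succ {X : Type*} (x : ℕ → X) (T s : ℕ) (z : X) [Decidable (T ≤ s ∧ x s = z)] :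
    visits x T (s + 1) z = visits x T s z + if T ≤ s ∧ x s = z then 1 else 0 := by
  classical
  unfold visits
  by_cases hT : T ≤ s
  · rw [← Finset.insert_Ico_right_eq_Ico_add_one hT, Finset.filter_insert]
    by_cases hz : x s = z
    · simp [hz, hT]
    · simp [hz]
  · rw [Finset.Ico_eq_empty (by omega), Finset.Ico_eq_empty (by omega)]
    simp [hT]

theorem visits_pos {X : Type*} {x : ℕ → X} {T s : ℕ} {z : X} :
    0 < visits x T s z ↔ ∃ v ∈ Finset.Ico T s, x v = z := by
  classical
  unfold visits
  rw [Finset.card_pos, Finset.filter_nonempty_iff]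

section

variable {X : Type*} [MetricSpace X] {μ : X → ℝ}

theorem IsPayoff.bddAbove (hμ : IsPayoff μ) : BddAbove (Set.range μ) :=
  ⟨1, by rintro _ ⟨x, rfl⟩; exact (hμ.mem_Icc x).2⟩

theorem IsPayoff.gap_nonneg (hμ : IsPayoff μ) (z : X) : 0 ≤ gap μ z :=
  sub_nonneg.2 (le_ciSup hμ.bddAbove z)

theorem IsPayoff.gap_le_one (hμ : IsPayoff μ) (z : X) : gap μ z ≤ 1 := by
  have : Nonempty X := ⟨z⟩
  have h1 : maxReward μ ≤ 1 := ciSup_le fun x => (hμ.mem_Icc x).2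
  have h2 := (hμ.mem_Icc z).1
  unfold gap
  linarith

theorem radius_pos {b : ℝ} (hb : 1 ≤ b) {n : ℕ} (hn : 0 < n) : 0 < radius b n := by
  unfold radius
  have : (0 : ℝ) < n := by exact_mod_cast hn
  positivity

theorem radius_sq_mul {b : ℝ} (hb : 1 ≤ b) {n : ℕ} (hn : 0 < n) : radius b n ^ 2 * n = b := by
  unfold radius
  have : (0 : ℝ) < n := by exact_mod_cast hn
  rw [Real.sq_sqrt (by positivity)]
  field_simp

/-- The rule of the zooming algorithm: the arm played in round `s` is either outside all the
confidence balls, or these cover the space and it is an active arm of the highest index. -/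
def ZoomingRule (x : ℕ → X) (est : ℕ → X → ℝ) (b : ℝ) (T s : ℕ) : Prop :=
  (∀ v ∈ Finset.Ico T s, radius b (visits x T s (x v)) ≤ dist (x s) (x v)) ∨
    ((∀ p, ∃ v ∈ Finset.Ico T s, dist p (x v) < radius b (visits x T s (x v))) ∧
      0 < visits x T s (x s) ∧
      ∀ v ∈ Finset.Ico T s, est s (x v) + 2 * radius b (visits x T s (x v)) ≤
        est s (x s) + 2 * radius b (visits x T s (x s)))

variable {x : ℕ → X} {est : ℕ → X → ℝ} {b : ℝ} {T H : ℕ}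

/-- A replayed arm lies in its own ball, so the balls must cover. Any `p` is then in the ball of
some active arm, whose index is at least `μ p`: one radius pays for the distance, one for the
estimate. The played arm has an even larger index, which exceeds its mean by at most three radii. -/
theorem gap_le_three_radius {s : ℕ} (hμ : IsPayoff μ) (hb : 1 ≤ b)
    (hrule : ZoomingRule x est b T s)
    (hclean : ∀ v ∈ Finset.Ico T s,
      |est s (x v) - μ (x v)| ≤ radius b (visits x T s (x v)))
    (hs : 0 < visits x T s (x s)) : gap μ (x s) ≤ 3 * radius b (visits x T s (x s)) := by
  obtain ⟨v, hv, hvs⟩ := visits_pos.1 hs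
  rcases hrule with h | ⟨hcov, -, hmax⟩
  · have := h v hv
    rw [hvs, dist_self] at this
    exact absurd (radius_pos hb hs) (not_lt.2 this)
  · have hne : Nonempty X := ⟨x s⟩
    have hc := abs_le.1 (hclean v hv)
    rw [hvs] at hc
    have : maxReward μ ≤ est s (x s) + 2 * radius b (visits x T s (x s)) := by
      refine ciSup_le fun p => ?_
      obtain ⟨w, hw, hd⟩ := hcov p
      have h1 := abs_le.1 (hclean w hw)
      have h2 := abs_le.1 (hμ.lipschitz p (x w))
      have h3 := hmax w hw
      linarith
    unfold gap
    linarith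

/-- Before a replay, `gap_le_three_radius` bounds the product by `9 * b`; the new play adds at most
`1 ≤ b`. -/
theorem visits_mul_gap_sq_le (hμ : IsPayoff μ) (hb : 1 ≤ b)
    (hrule : ∀ s ∈ Finset.Ico T H, ZoomingRule x est b T s)
    (hclean : ∀ s ∈ Finset.Ico T H, ∀ v ∈ Finset.Ico T s,
      |est s (x v) - μ (x v)| ≤ radius b (visits x T s (x v)))
    (z : X) : ∀ s ≤ H, visits x T s z * gap μ z ^ 2 ≤ 10 * b := by
  classical
  intro s
  have hg0 := hμ.gap_nonneg z
  have hg1 := hμ.gap_le_one z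
  have hgg : gap μ z ^ 2 ≤ 1 := by nlinarith
  induction s with
  | zero => intro _; simp [visits]; linarith
  | succ s ih =>
    intro hs
    rw [visits_succ]
    split_ifs with h
    · obtain ⟨hT, rfl⟩ := h
      have hmem : s ∈ Finset.Ico T H := Finset.mem_Ico.2 ⟨hT, by omega⟩
      rcases Nat.eq_zero_or_pos (visits x T s (x s)) with h0 | h0
      · rw [h0]; push_cast; linarith
      · have h3 := gap_le_three_radius hμ hb (hrule s hmem) (hclean s hmem) h0
        have h4 := radius_sq_mul hb h0
        have h5 : gap μ (x s) ^ 2 ≤ (3 * radius b (visits x T s (x s))) ^ 2 :=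
          pow_le_pow_left₀ hg0 h3 2
        have h6 : (0 : ℝ) ≤ visits x T s (x s) := by positivity
        push_cast
        nlinarith [mul_le_mul_of_nonneg_right h5 h6]
    · simpa using ih (by omega)

/-- A new arm avoids the ball of `x u`, whose squared radius is at least `gap² / 10 > r² / 40 > (r /
8)²`. -/
theorem dist_gt_of_layer (hμ : IsPayoff μ) (hb : 1 ≤ b)
    (hrule : ∀ s ∈ Finset.Ico T H, ZoomingRule x est b T s)
    (hclean : ∀ s ∈ Finset.Ico T H, ∀ v ∈ Finset.Ico T s,
      |est s (x v) - μ (x v)| ≤ radius b (visits x T s (x v)))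
    {r : ℝ} (hr : 0 < r) {u v : ℕ} (hu : T ≤ u) (huv : u < v) (hv : v < H)
    (hnew : visits x T v (x v) = 0) (hl : x u ∈ layer μ r) : r / 8 < dist (x v) (x u) := by
  have hvm : v ∈ Finset.Ico T H := Finset.mem_Ico.2 ⟨by omega, hv⟩
  have hum : u ∈ Finset.Ico T v := Finset.mem_Ico.2 ⟨hu, huv⟩
  have hpos : 0 < visits x T v (x u) := visits_pos.2 ⟨u, hum, rfl⟩
  rcases hrule v hvm with h | ⟨-, h, -⟩
  · refine lt_of_lt_of_le ?_ (h u hum)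
    have h1 := visits_mul_gap_sq_le hμ hb hrule hclean (x u) v hv.le
    have h2 := radius_sq_mul hb hpos
    have h3 := (mem_layer.1 hl).1
    have h4 : (0 : ℝ) < visits x T v (x u) := by exact_mod_cast hpos
    have h5 : gap μ (x u) ^ 2 ≤ 10 * radius b (visits x T v (x u)) ^ 2 := by
      rw [← h2] at h1
      exact le_of_mul_le_mul_right (by linarith) h4
    have h6 := (radius_pos hb hpos).le
    nlinarith
  · omega

/-- On the clean event, the number of rounds of a phase that are spent in a layer is at most the
covering number of the layer times the maximal number of plays of an arm in the layer. -/
theorem card_layer_le (hμ : IsPayoff μ) (hb : 1 ≤ b)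
    (hrule : ∀ s ∈ Finset.Ico T H, ZoomingRule x est b T s)
    (hclean : ∀ s ∈ Finset.Ico T H, ∀ v ∈ Finset.Ico T s,
      |est s (x v) - μ (x v)| ≤ radius b (visits x T s (x v)))
    {r N : ℝ} (hr : 0 < r) (hcov : CoverableBy (layer μ r) N (r / 8))
    [DecidablePred fun v => x v ∈ layer μ r] :
    (((Finset.Ico T H).filter (fun v => x v ∈ layer μ r)).card : ℝ) ≤ N * (40 * b / r ^ 2) := by
  classical
  obtain ⟨F, hF, hdiam, hcov⟩ := hcov
  set A := (Finset.Ico T H).filter (fun v => x v ∈ layer μ r) with hA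
  have hlayer : ∀ z ∈ A.image x, z ∈ layer μ r := by
    intro z hz
    obtain ⟨v, hv, rfl⟩ := Finset.mem_image.1 hz
    exact (Finset.mem_filter.1 hv).2
  -- Of two arms, the one whose first play comes later is new at that time, so separation is tested
  -- at first plays.
  have hfirst : ∀ z ∈ A.image x, ∃ v, T ≤ v ∧ v < H ∧ x v = z ∧ visits x T v z = 0 := by
    intro z hz
    obtain ⟨v, hv, rfl⟩ := Finset.mem_image.1 hz
    have hvI := Finset.mem_Ico.1 (Finset.mem_filter.1 hv).1
    have hex : ∃ w, T ≤ w ∧ w < H ∧ x w = x v := ⟨v, hvI.1, hvI.2, rfl⟩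
    refine ⟨Nat.find hex, (Nat.find_spec hex).1, (Nat.find_spec hex).2.1,
      (Nat.find_spec hex).2.2, ?_⟩
    by_contra h
    obtain ⟨w, hw, hxw⟩ := visits_pos.1 (Nat.pos_of_ne_zero h)
    have hwI := Finset.mem_Ico.1 hw
    have := (Nat.find_spec hex).2.1
    exact Nat.find_min hex hwI.2 ⟨hwI.1, by omega, hxw⟩
  have hsep : ∀ z ∈ A.image x, ∀ z' ∈ A.image x, z ≠ z' → r / 8 < dist z z' := by
    intro z hz z' hz' hne
    obtain ⟨v, hTv, hvH, rfl, hv0⟩ := hfirst z hz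
    obtain ⟨v', hTv', hvH', rfl, hv0'⟩ := hfirst z' hz'
    rcases lt_trichotomy v v' with h | h | h
    · rw [dist_comm]
      exact dist_gt_of_layer hμ hb hrule hclean hr hTv h hvH' hv0' (hlayer _ hz)
    · exact absurd (by rw [h]) hne
    · exact dist_gt_of_layer hμ hb hrule hclean hr hTv' h hvH hv0 (hlayer _ hz')
  -- A covering set of diameter at most `r / 8` contains at most one of the separated arms.
  have hcard : (A.image x).card ≤ F.card := by
    choose! S hSF hS using fun z (hz : z ∈ layer μ r) => hcov z hz
    refine Finset.card_le_card_of_injOn S (fun z hz => hSF z (hlayer z hz)) ?_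
    intro z hz z' hz' hSS
    by_contra hne
    have h1 := hsep z hz z' hz' hne
    have h2 := hdiam (S z) (hSF z (hlayer z hz)) z (hS z (hlayer z hz)) z'
      (hSS ▸ hS z' (hlayer z' hz'))
    linarith
  have hfib : ∀ z ∈ A.image x, ((A.filter (fun v => x v = z)).card : ℝ) ≤ 40 * b / r ^ 2 := by
    intro z hz
    have h1 := visits_mul_gap_sq_le hμ hb hrule hclean z H le_rfl
    have h2 : ((A.filter (fun v => x v = z)).card : ℝ) ≤ visits x T H z := by
      unfold visits
      exact_mod_cast Finset.card_le_card
        ((Finset.filter_subset_filter _ (Finset.filter_subset _ _)).trans (fun v => by simp))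
    have h3 := (mem_layer.1 (hlayer z hz)).1
    rw [le_div_iff₀ (by positivity)]
    have h4 : (r / 2) ^ 2 ≤ gap μ z ^ 2 := pow_le_pow_left₀ (by positivity) h3.le 2
    have h5 : (0 : ℝ) ≤ visits x T H z := by positivity
    nlinarith [mul_le_mul_of_nonneg_left h4 h5, mul_le_mul_of_nonneg_right h2 (sq_nonneg r)]
  rw [Finset.card_eq_sum_card_image x A]
  push_cast
  refine (Finset.sum_le_card_nsmul _ _ _ hfib).trans ?_
  rw [nsmul_eq_mul]
  have : ((A.image x).card : ℝ) ≤ N := le_trans (by exact_mod_cast hcard) hF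
  gcongr

end

end LipschitzBandit

/-! ### Phases of doubly exponential length -/

namespace LipschitzBandit

/-- The round in which the phase of round `t` starts: the largest number `2 ^ 2 ^ k` that is at
most `t` (and `2` if there is none). -/
def phaseStart (t : ℕ) : ℕ := 2 ^ 2 ^ Nat.log 2 (Nat.log 2 t)

theorem two_le_phaseStart (t : ℕ) : 2 ≤ phaseStart t :=
  Nat.le_self_pow (by positivity) 2

theorem phaseStart_le {t : ℕ} (ht : 2 ≤ t) : phaseStart t ≤ t := by
  have h : Nat.log 2 t ≠ 0 := (Nat.log_pos (by norm_num) ht).ne'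
  exact (Nat.pow_le_pow_right (by norm_num) (Nat.pow_log_le_self 2 h)).trans
    (Nat.pow_log_le_self 2 (by omega))

theorem lt_phaseStart_sq (t : ℕ) : t < phaseStart t ^ 2 := by
  unfold phaseStart
  rw [← pow_mul, ← pow_succ]
  refine (Nat.lt_pow_succ_log_self (b := 2) (by norm_num) t).trans_le ?_
  exact Nat.pow_le_pow_right (by norm_num) (Nat.lt_pow_succ_log_self (by norm_num) _)

theorem phaseStart_eq {k t : ℕ} (h1 : 2 ^ 2 ^ k ≤ t) (h2 : t < (2 ^ 2 ^ k) ^ 2) :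
    phaseStart t = 2 ^ 2 ^ k := by
  unfold phaseStart
  have ht : t ≠ 0 := by have : 0 < 2 ^ 2 ^ k := by positivity
                        omega
  rw [← pow_mul, ← pow_succ] at h2
  have h3 : 2 ^ k ≤ Nat.log 2 t := Nat.le_log_of_pow_le (by norm_num) h1
  have h4 : Nat.log 2 t < 2 ^ (k + 1) := Nat.log_lt_of_lt_pow ht h2
  rw [Nat.log_eq_of_pow_le_of_lt_pow h3 h4]

theorem phaseStart_eq_of_mem {t s : ℕ} (hs : s ∈ Finset.Ico (phaseStart t) (phaseStart t ^ 2)) :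
    phaseStart s = phaseStart t :=
  phaseStart_eq (Finset.mem_Ico.1 hs).1 (Finset.mem_Ico.1 hs).2

/-- Every phase is preceded by a phase that is the first one or starts before `√t`. -/
theorem exists_previous_phase {t : ℕ} (ht : 2 ≤ t) :
    ∃ t', phaseStart t' ≤ phaseStart t ∧ phaseStart t ≤ phaseStart t' ^ 2 ∧
      phaseStart t' ^ 2 ≤ 4 * t := by
  rcases hk : Nat.log 2 (Nat.log 2 t) with _ | k
  -- The first phase starts at `2` and serves as its own predecessor; `2 ^ 2 ≤ 4 * t` is where the
  -- factor `4` comes from.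
  · refine ⟨t, le_rfl, Nat.le_self_pow (by norm_num) _, ?_⟩
    simp only [phaseStart, hk]
    omega
  · have h1 := phaseStart_le ht
    have h2 : phaseStart t = (2 ^ 2 ^ k) ^ 2 := by
      rw [phaseStart, hk, ← pow_mul, ← pow_succ]
    have h3 : phaseStart (2 ^ 2 ^ k) = 2 ^ 2 ^ k :=
      phaseStart_eq le_rfl (lt_self_pow₀ (Nat.one_lt_two_pow (by positivity)) (by norm_num))
    refine ⟨2 ^ 2 ^ k, ?_⟩
    rw [h3, h2]
    exact ⟨Nat.le_self_pow (by norm_num) _, le_rfl, by omega⟩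

/-! ### The algorithm, with restarts and rounded rewards -/

section Algorithm

variable {X : Type*}

open Classical in
/-- The number of rounds after round `T` of the history in which `z` is played. -/
noncomputable def countPlays (T : ℕ) (z : X) : List (Round X) → ℕ
  | [] => 0
  | r :: h => countPlays T z h + if T ≤ h.length ∧ r.strategy = z then 1 else 0

open Classical in
/-- The total reward that `z` has earned after round `T` of the history. -/
noncomputable def sumRewards (T : ℕ) (z : X) : List (Round X) → ℝ
  | [] => 0
  | r :: h => sumRewards T z h + if T ≤ h.length ∧ r.strategy = z then r.reward else 0

/-- The arms played after round `T` of the history. -/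
def activeArms (T : ℕ) : List (Round X) → List X
  | [] => []
  | r :: h => if T ≤ h.length then r.strategy :: activeArms T h else activeArms T h

/-- The squared confidence radius of an arm played once, in the phase starting in round `T`. -/
noncomputable def confidence (σ : ℝ) (T : ℕ) : ℝ := 40 * max 1 σ ^ 2 * Real.log ((T : ℝ) ^ 2)

/-- Taking `max 1 σ` instead of `σ` ensures this for small noise. It lets `b` absorb the loss of one
extra play, and the radius absorb the rounding error. -/
theorem one_le_confidence (σ : ℝ) {T : ℕ} (hT : 2 ≤ T) : 1 ≤ confidence σ T := by
  unfold confidence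
  have h1 : 1 ≤ max 1 σ ^ 2 := one_le_pow₀ (le_max_left _ _)
  have h2 : (2 : ℝ) ≤ T := by exact_mod_cast hT
  have h3 : Real.log 2 ≤ Real.log ((T : ℝ) ^ 2) := Real.log_le_log (by norm_num) (by nlinarith)
  have h4 := Real.log_two_gt_d9
  nlinarith

/-- The confidence radius of the arm `z` in the phase starting in round `T`. -/
noncomputable def armRadius (σ : ℝ) (T : ℕ) (h : List (Round X)) (z : X) : ℝ :=
  radius (confidence σ T) (countPlays T z h)

/-- The index of the arm `z` in the phase starting in round `T`. -/
noncomputable def armIndex (σ : ℝ) (T : ℕ) (h : List (Round X)) (z : X) : ℝ :=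
  sumRewards T z h / countPlays T z h + 2 * armRadius σ T h z

/-- The zooming algorithm, restarted at the beginning of each phase. It plays a point that is not
covered by the confidence balls of the active arms, and an active arm of maximal index if there
is none. -/
noncomputable def zooming (X : Type*) [Nonempty X] (σ : ℝ) : Algorithm X where
  query h := (activeArms (phaseStart h.length) h).map
    fun z => (z, armRadius σ (phaseStart h.length) h z)
  play h a := a.getD
    (((activeArms (phaseStart h.length) h).argmax (armIndex σ (phaseStart h.length) h)).getD
      -- Never reached with a genuine oracle: without active arms the query is empty, and an empty
      -- family cannot cover a nonempty space.
      (Classical.arbitrary X))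

/-- Rounding down to a multiple of `1 / N`. -/
noncomputable def roundTo (N : ℕ) (y : ℝ) : ℝ := (⌊N * y⌋ : ℤ) / N

theorem abs_roundTo_sub_le {N : ℕ} (hN : 0 < N) (y : ℝ) : |roundTo N y - y| ≤ 1 / N := by
  have hN' : (0 : ℝ) < N := by exact_mod_cast hN
  have h1 := Int.floor_le ((N : ℝ) * y)
  have h2 := Int.lt_floor_add_one ((N : ℝ) * y)
  have : roundTo N y - y = ((⌊N * y⌋ : ℤ) - N * y) / N := by
    unfold roundTo; field_simp
  rw [this, abs_div, abs_of_pos hN']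
  gcongr
  rw [abs_le]
  constructor <;> linarith

/-- The history with the rewards of the round `s` rounded to multiples of `1 / N s`. -/
noncomputable def roundHistory (N : ℕ → ℕ) : List (Round X) → List (Round X)
  | [] => []
  -- The tail holds the earlier rounds, so its length is the index of the round `r`.
  | r :: h => ⟨r.reply, r.strategy, roundTo (N h.length) r.reward⟩ :: roundHistory N h

/-- The algorithm `A`, fed with rounded rewards. -/
noncomputable def Algorithm.rounded (A : Algorithm X) (N : ℕ → ℕ) : Algorithm X where
  query h := A.query (roundHistory N h)
  play h a := A.play (roundHistory N h) a

/-- The precision to which the rewards of the round `s` are rounded. -/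
def precision (s : ℕ) : ℕ := phaseStart s ^ 2

variable (A : Algorithm X) (O : List (X × ℝ) → Option X) (μ : X → ℝ) (ξ : ℕ → ℝ) (N : ℕ → ℕ)

theorem Algorithm.history_succ (s : ℕ) : A.history O μ ξ (s + 1) =
    ⟨O (A.query (A.history O μ ξ s)), A.strategyAt O μ ξ s, A.rewardAt O μ ξ s⟩ ::
      A.history O μ ξ s := rfl

@[simp] theorem Algorithm.length_history (s : ℕ) : (A.history O μ ξ s).length = s := by
  induction s with
  | zero => rfl
  | succ s ih => rw [Algorithm.history_succ, List.length_cons, ih]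

@[simp] theorem length_roundHistory (h : List (Round X)) :
    (roundHistory N h).length = h.length := by
  induction h with
  | nil => rfl
  | cons r h ih => rw [roundHistory, List.length_cons, ih, List.length_cons]

/-- The history with rounded rewards. -/
noncomputable def Algorithm.roundedHistory (s : ℕ) : List (Round X) :=
  roundHistory N (A.history O μ ξ s)

@[simp] theorem Algorithm.length_roundedHistory (s : ℕ) :
    (A.roundedHistory O μ ξ N s).length = s := by
  simp [roundedHistory]

theorem Algorithm.roundedHistory_succ (s : ℕ) : A.roundedHistory O μ ξ N (s + 1) =
    ⟨O (A.query (A.history O μ ξ s)), A.strategyAt O μ ξ s,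
      roundTo (N s) (A.rewardAt O μ ξ s)⟩ :: A.roundedHistory O μ ξ N s := by
  rw [roundedHistory, history_succ, roundHistory, length_history, roundedHistory]

theorem countPlays_roundedHistory (T s : ℕ) (z : X) :
    countPlays T z (A.roundedHistory O μ ξ N s) = visits (A.strategyAt O μ ξ) T s z := by
  classical
  induction s with
  | zero => simp [visits, Algorithm.roundedHistory, Algorithm.history, roundHistory, countPlays]
  | succ s ih =>
    rw [Algorithm.roundedHistory_succ, countPlays, ih, visits_succ, Algorithm.length_roundedHistory]

theorem mem_activeArms_roundedHistory (T s : ℕ) (z : X) :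
    z ∈ activeArms T (A.roundedHistory O μ ξ N s) ↔
      ∃ v ∈ Finset.Ico T s, A.strategyAt O μ ξ v = z := by
  induction s with
  | zero => simp [Algorithm.roundedHistory, Algorithm.history, roundHistory, activeArms]
  | succ s ih =>
    rw [Algorithm.roundedHistory_succ, activeArms, Algorithm.length_roundedHistory]
    split_ifs with h
    · rw [← Finset.insert_Ico_right_eq_Ico_add_one h, List.mem_cons, ih]
      simp [eq_comm]
    · rw [ih, Finset.Ico_eq_empty (by omega), Finset.Ico_eq_empty (by omega)]

open Classical in
theorem sumRewards_roundedHistory (T s : ℕ) (z : X) :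
    sumRewards T z (A.roundedHistory O μ ξ N s) =
      ∑ v ∈ (Finset.Ico T s).filter (fun v => A.strategyAt O μ ξ v = z),
        roundTo (N v) (A.rewardAt O μ ξ v) := by
  induction s with
  | zero => simp [Algorithm.roundedHistory, Algorithm.history, roundHistory, sumRewards]
  | succ s ih =>
    rw [Algorithm.roundedHistory_succ, sumRewards, ih, Algorithm.length_roundedHistory]
    by_cases h : T ≤ s
    · rw [← Finset.insert_Ico_right_eq_Ico_add_one h, Finset.filter_insert]
      by_cases hz : A.strategyAt O μ ξ s = z
      · simp [hz, h, add_comm]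
      · simp [hz]
    · rw [Finset.Ico_eq_empty (by omega), Finset.Ico_eq_empty (by omega)]
      simp [h]

theorem Algorithm.strategyAt_rounded (s : ℕ) :
    (A.rounded N).strategyAt O μ ξ s =
      A.play ((A.rounded N).roundedHistory O μ ξ N s)
        (O (A.query ((A.rounded N).roundedHistory O μ ξ N s))) := rfl

/-- The algorithm of the theorem: the zooming algorithm with rounded rewards. -/
noncomputable def roundedZooming (X : Type*) [Nonempty X] (σ : ℝ) : Algorithm X :=
  (zooming X σ).rounded precision

/-- The average rounded reward of the arm `z` in the rounds of `[T, s)`. -/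
noncomputable def average (T s : ℕ) (z : X) : ℝ :=
  sumRewards T z (A.roundedHistory O μ ξ precision s) / visits (A.strategyAt O μ ξ) T s z

/-- The two possible replies of the oracle are the two alternatives of the rule. -/
theorem zoomingRule_roundedZooming {X : Type*} [MetricSpace X] [Nonempty X] (σ : ℝ)
    {O : List (X × ℝ) → Option X} (hO : IsCoveringOracle O) (μ : X → ℝ) (ξ : ℕ → ℝ)
    {s t : ℕ} (hs : s ∈ Finset.Ico (phaseStart t) (phaseStart t ^ 2)) :
    ZoomingRule ((roundedZooming X σ).strategyAt O μ ξ)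
      (average (roundedZooming X σ) O μ ξ (phaseStart t)) (confidence σ (phaseStart t))
      (phaseStart t) s := by
  have hT := phaseStart_eq_of_mem hs
  have hstrat : (roundedZooming X σ).strategyAt O μ ξ s = _ :=
    (zooming X σ).strategyAt_rounded O μ ξ precision s
  change _ = (zooming X σ).play ((roundedZooming X σ).roundedHistory O μ ξ precision s)
    (O ((zooming X σ).query ((roundedZooming X σ).roundedHistory O μ ξ precision s))) at hstrat
  set T := phaseStart t
  set A := roundedZooming X σ
  set h := A.roundedHistory O μ ξ precision s with hh
  have hlen : h.length = s := A.length_roundedHistory O μ ξ precision s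
  have hmem := mem_activeArms_roundedHistory A O μ ξ precision T s
  have hrad : ∀ z, armRadius σ T h z =
      radius (confidence σ T) (visits (A.strategyAt O μ ξ) T s z) := fun z => by
    rw [armRadius, countPlays_roundedHistory]
  have hidx : ∀ z, armIndex σ T h z = average A O μ ξ T s z +
      2 * radius (confidence σ T) (visits (A.strategyAt O μ ξ) T s z) := fun z => by
    rw [armIndex, countPlays_roundedHistory, hrad, average]
  have hq : (zooming X σ).query h = (activeArms T h).map fun z => (z, armRadius σ T h z) := by
    simp only [zooming, hlen, hT]
  rw [hq] at hstrat
  rcases hOa : O ((activeArms T h).map fun z => (z, armRadius σ T h z)) with _ | y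
  · right
    have hcov : ∀ p, ∃ v ∈ Finset.Ico T s, dist p (A.strategyAt O μ ξ v) <
        radius (confidence σ T) (visits (A.strategyAt O μ ξ) T s (A.strategyAt O μ ξ v)) := by
      intro p
      obtain ⟨b, hb, hpb⟩ := hO.covered _ hOa p
      obtain ⟨z, hz, rfl⟩ := List.mem_map.1 hb
      obtain ⟨v, hv, rfl⟩ := (hmem z).1 hz
      exact ⟨v, hv, by rw [← hrad]; exact hpb⟩
    rw [hOa] at hstrat
    simp only [zooming, hlen, hT, Option.getD_none] at hstrat
    -- Covering a nonempty space requires an active arm, so the maximal index is attained.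
    obtain ⟨w, hw, -⟩ := hcov (Classical.arbitrary X)
    rcases hm : (activeArms T h).argmax (armIndex σ T h) with _ | z
    · rw [List.argmax_eq_none] at hm
      have := (hmem _).2 ⟨w, hw, rfl⟩
      rw [hm] at this
      simp at this
    · rw [hm, Option.getD_some] at hstrat
      have hz := List.argmax_mem hm
      rw [hstrat]
      refine ⟨hcov, visits_pos.2 ((hmem z).1 hz), fun v hv => ?_⟩
      rw [← hidx, ← hidx]
      exact List.le_of_mem_argmax ((hmem _).2 ⟨v, hv, rfl⟩) hm
  · left
    intro v hv
    rw [hOa] at hstrat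
    simp only [zooming, Option.getD_some] at hstrat
    rw [← hrad, hstrat, ← not_lt]
    exact hO.uncovered _ y hOa (_, _)
      (List.mem_map.2 ⟨A.strategyAt O μ ξ v, (hmem _).2 ⟨v, hv, rfl⟩, rfl⟩)

end Algorithm

end LipschitzBandit

/-! ### Measurability through integer codes of the rewards -/

namespace LipschitzBandit

section Codes

variable {X : Type*} (A : Algorithm X) (O : List (X × ℝ) → Option X) (μ : X → ℝ) (N : ℕ → ℕ)

/-- The rewards of the first rounds in units of `1 / N s`, rounded down to integers. -/
noncomputable def rewardCodes (ξ : ℕ → ℝ) : ℕ → List ℤ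
  | 0 => []
  | s + 1 => ⌊N s * A.rewardAt O μ ξ s⌋ :: rewardCodes ξ s

/-- The history with rounded rewards, reconstructed from the reward codes. -/
noncomputable def decodeHistory : List ℤ → List (Round X)
  | [] => []
  | c :: l => ⟨O (A.query (decodeHistory l)),
      A.play (decodeHistory l) (O (A.query (decodeHistory l))), c / N l.length⟩ :: decodeHistory l

@[simp] theorem length_rewardCodes (ξ : ℕ → ℝ) (s : ℕ) :
    (rewardCodes A O μ N ξ s).length = s := by
  induction s with
  | zero => rfl
  | succ s ih => rw [rewardCodes, List.length_cons, ih]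

/-- Replies and strategies are functions of the earlier rounded rewards, so the codes alone
determine the history. -/
theorem roundedHistory_rounded (ξ : ℕ → ℝ) (s : ℕ) :
    (A.rounded N).roundedHistory O μ ξ N s =
      decodeHistory A O N (rewardCodes (A.rounded N) O μ N ξ s) := by
  induction s with
  | zero => rfl
  | succ s ih =>
    rw [Algorithm.roundedHistory_succ, rewardCodes, decodeHistory, ← ih, length_rewardCodes]
    rfl

theorem strategyAt_rounded_eq_decode (ξ : ℕ → ℝ) (s : ℕ) :
    (A.rounded N).strategyAt O μ ξ s =
      A.play (decodeHistory A O N (rewardCodes (A.rounded N) O μ N ξ s))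
        (O (A.query (decodeHistory A O N (rewardCodes (A.rounded N) O μ N ξ s)))) := by
  rw [Algorithm.strategyAt_rounded, roundedHistory_rounded]

/-- The type is countable, so this discrete structure is compatible with products, and every map out
of it is measurable. -/
instance : MeasurableSpace (List ℤ) := ⊤

variable {Ω : Type*} [MeasurableSpace Ω] {η : ℕ → Ω → ℝ}

/-- Only the noise before round `s` enters. The σ-algebra on `Ω` can therefore be taken to be `past
η s`, which yields predictability. -/
theorem measurable_rewardCodes (s : ℕ) (hη : ∀ i < s, Measurable (η i)) :
    Measurable fun ω => rewardCodes (A.rounded N) O μ N (fun k => η k ω) s := by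
  induction s with
  | zero => exact measurable_const
  | succ s ih =>
    have ih := ih fun i hi => hη i (by omega)
    have h1 : Measurable fun ω => μ ((A.rounded N).strategyAt O μ (fun k => η k ω) s) := by
      simp only [strategyAt_rounded_eq_decode]
      exact (measurable_from_top (f := fun l => μ (A.play (decodeHistory A O N l)
        (O (A.query (decodeHistory A O N l)))))).comp ih
    have h2 : Measurable fun ω =>
        ⌊N s * (A.rounded N).rewardAt O μ (fun k => η k ω) s⌋ :=
      ((h1.add (hη s (by omega))).const_mul _).floor
    exact (Measurable.of_discrete (f := fun p : ℤ × List ℤ => p.1 :: p.2)).comp (h2.prodMk ih)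

theorem measurable_comp_strategyAt {β : Type*} [MeasurableSpace β] (f : X → β) (s : ℕ)
    (hη : ∀ i < s, Measurable (η i)) :
    Measurable fun ω => f ((A.rounded N).strategyAt O μ (fun k => η k ω) s) := by
  simp only [strategyAt_rounded_eq_decode]
  exact (measurable_from_top (f := fun l => f (A.play (decodeHistory A O N l)
    (O (A.query (decodeHistory A O N l)))))).comp (measurable_rewardCodes A O μ N s hη)

theorem measurableSet_strategyAt_eq (s u : ℕ) (hus : u ≤ s)
    (hη : ∀ i < s, Measurable (η i)) :
    MeasurableSet {ω | (A.rounded N).strategyAt O μ (fun k => η k ω) s =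
      (A.rounded N).strategyAt O μ (fun k => η k ω) u} := by
  simp only [strategyAt_rounded_eq_decode]
  exact ((measurable_rewardCodes A O μ N s hη).prodMk (measurable_rewardCodes A O μ N u
    fun i hi => hη i (by omega))) (MeasurableSet.of_discrete (s := {p : List ℤ × List ℤ |
      A.play (decodeHistory A O N p.1) (O (A.query (decodeHistory A O N p.1))) =
      A.play (decodeHistory A O N p.2) (O (A.query (decodeHistory A O N p.2)))}))

end Codes

/-! ### Gaussian deviations of predictably selected noise -/

section Tilt

variable {Ω : Type*}

/-- The information contained in the noise of the rounds before round `s`. -/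
@[reducible] def past (η : ℕ → Ω → ℝ) (s : ℕ) : MeasurableSpace Ω :=
  ⨆ i ∈ Set.Iio s, MeasurableSpace.comap (η i) inferInstance

theorem measurable_past (η : ℕ → Ω → ℝ) {i s : ℕ} (hi : i < s) : Measurable[past η s] (η i) :=
  measurable_iff_comap_le.2 (le_iSup₂_of_le i (Set.mem_Iio.2 hi) le_rfl)

theorem past_mono (η : ℕ → Ω → ℝ) {s t : ℕ} (h : s ≤ t) : past η s ≤ past η t :=
  biSup_mono fun _ hi => lt_of_lt_of_le hi h

/-- The exponential of the noise, normalized to have expectation `1`. -/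
noncomputable def tilt (η : ℕ → Ω → ℝ) (σ : NNReal) (l : ℝ) (v : ℕ) (ω : Ω) : ENNReal :=
  ENNReal.ofReal (Real.exp (l * η v ω - l ^ 2 * σ ^ 2 / 2))

open Classical in
/-- The product of the tilts over the rounds in which the predictable event `J v` occurs. -/
noncomputable def tiltProd (η : ℕ → Ω → ℝ) (σ : NNReal) (l : ℝ) (J : ℕ → Set Ω) (s : ℕ) (ω : Ω) :
    ENNReal :=
  ∏ v ∈ Finset.range s, if ω ∈ J v then tilt η σ l v ω else 1

theorem measurable_tilt [MeasurableSpace Ω] {η : ℕ → Ω → ℝ} (σ : NNReal) (l : ℝ) {v : ℕ}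
    (hη : Measurable (η v)) : Measurable (tilt η σ l v) := by
  unfold tilt
  fun_prop

theorem measurable_tiltProd [MeasurableSpace Ω] {η : ℕ → Ω → ℝ} (σ : NNReal) (l : ℝ)
    {J : ℕ → Set Ω} {s : ℕ} (hη : ∀ v < s, Measurable (η v)) (hJ : ∀ v < s, MeasurableSet (J v)) :
    Measurable (tiltProd η σ l J s) := by
  classical
  unfold tiltProd
  refine Finset.measurable_fun_prod _ fun v hv => ?_
  have hv := Finset.mem_range.1 hv
  exact Measurable.ite (hJ v hv) (measurable_tilt σ l (hη v hv)) measurable_const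

variable [mΩ : MeasurableSpace Ω] {P : Measure Ω} {η : ℕ → Ω → ℝ}
  {σ : NNReal}

theorem past_le (hη : ∀ s, Measurable (η s)) (s : ℕ) : past η s ≤ mΩ :=
  iSup₂_le fun i _ => (hη i).comap_le

theorem indep_past (hη : ∀ s, Measurable (η s)) (hind : iIndepFun η P) (s : ℕ) :
    Indep (past η s) (MeasurableSpace.comap (η s) inferInstance) P := by
  have h := indep_iSup_of_disjoint (fun i => (hη i).comap_le) hind.iIndep
    (S := Set.Iio s) (T := {s}) (by simp)
  simpa [past] using h

theorem lintegral_tilt (hlaw : ∀ s, HasLaw (η s) (gaussianReal 0 (σ ^ 2)) P) (l : ℝ) (v : ℕ) :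
    ∫⁻ ω, tilt η σ l v ω ∂P = 1 := by
  have h1 := (hlaw v).lintegral_comp
    (f := fun x => ENNReal.ofReal (Real.exp (l * x - l ^ 2 * σ ^ 2 / 2))) (by fun_prop)
  unfold tilt
  rw [h1]
  have h2 : ∀ x : ℝ, Real.exp (l * x - l ^ 2 * σ ^ 2 / 2) =
      Real.exp (l * x) * Real.exp (-(l ^ 2 * σ ^ 2 / 2)) := fun x => by
    rw [← Real.exp_add]; ring_nf
  simp only [h2]
  rw [← ofReal_integral_eq_lintegral_ofReal
    ((integrable_exp_mul_gaussianReal l).mul_const _) (Filter.Eventually.of_forall fun x => by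
      positivity), integral_mul_const]
  have h3 := congrFun (mgf_fun_id_gaussianReal (μ := 0) (v := σ ^ 2)) l
  unfold mgf at h3
  rw [h3, ← Real.exp_add]
  simp only [NNReal.coe_pow]
  ring_nf
  simp

variable [IsProbabilityMeasure P]

/-- Martingale step: the product so far and `J s` depend on the past, while the tilt of round `s` is
independent of it and has mean one. Whether or not the factor is included, the integral is
unchanged. -/
theorem lintegral_tiltProd (hη : ∀ s, Measurable (η s)) (hind : iIndepFun η P)
    (hlaw : ∀ s, HasLaw (η s) (gaussianReal 0 (σ ^ 2)) P) {J : ℕ → Set Ω}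
    (hJ : ∀ v, MeasurableSet[past η v] (J v)) (l : ℝ) (s : ℕ) :
    ∫⁻ ω, tiltProd η σ l J s ω ∂P = 1 := by
  classical
  induction s with
  | zero => simp [tiltProd]
  | succ s ih =>
    have hM : Measurable[past η s] (tiltProd η σ l J s) :=
      @measurable_tiltProd Ω (past η s) η σ l J s (fun v hv => measurable_past η hv)
        (fun v hv => past_mono η hv.le _ (hJ v))
    have hle := past_le hη s
    have hJs : MeasurableSet (J s) := hle _ (hJ s)
    have hMJ : Measurable[past η s] ((J s).indicator (tiltProd η σ l J s)) := hM.indicator (hJ s)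
    have hstep : ∀ ω, tiltProd η σ l J (s + 1) ω =
        (J s).indicator (tiltProd η σ l J s) ω * tilt η σ l s ω +
          (J s)ᶜ.indicator (tiltProd η σ l J s) ω := fun ω => by
      rw [tiltProd, Finset.prod_range_succ, ← tiltProd]
      by_cases h : ω ∈ J s <;> simp [h]
    have htilt : Measurable[MeasurableSpace.comap (η s) inferInstance] (tilt η σ l s) :=
      @measurable_tilt Ω (MeasurableSpace.comap (η s) inferInstance) η σ l s
        (comap_measurable (η s))
    have hM' : Measurable (tiltProd η σ l J s) := hM.mono hle le_rfl
    simp only [hstep]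
    rw [lintegral_add_right _ (hM'.indicator hJs.compl),
      lintegral_mul_eq_lintegral_mul_lintegral_of_independent_measurableSpace hle
        (hη s).comap_le (indep_past hη hind s) hMJ htilt, lintegral_tilt hlaw, mul_one,
      ← lintegral_add_right _ (hM'.indicator hJs.compl), ← ih]
    congr 1 with ω
    exact congrFun (Set.indicator_self_add_compl (J s) (tiltProd η σ l J s)) ω

open Classical in
/-- The rounds before round `s` in which `J` occurs. -/
noncomputable def occurrences (J : ℕ → Set Ω) (s : ℕ) (ω : Ω) : Finset ℕ :=
  (Finset.range s).filter fun v => ω ∈ J v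

/-- Chernoff's bound with the optimal parameter `ρ / σ ^ 2`; `ε = ±1` selects the tail. Fixing the
number of occurrences makes the normalization of the tilted product deterministic on the event. -/
theorem measure_le_exp (hσ : 0 < σ) (hη : ∀ s, Measurable (η s)) (hind : iIndepFun η P)
    (hlaw : ∀ s, HasLaw (η s) (gaussianReal 0 (σ ^ 2)) P) {J : ℕ → Set Ω}
    (hJ : ∀ v, MeasurableSet[past η v] (J v)) (s m : ℕ) (ρ ε : ℝ) (hε : ε ^ 2 = 1)
    (hρ : 0 ≤ ρ) :
    P {ω | (occurrences J s ω).card = m ∧ m * ρ ≤ ε * ∑ v ∈ occurrences J s ω, η v ω} ≤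
      ENNReal.ofReal (Real.exp (-(m * ρ ^ 2 / (2 * σ ^ 2)))) := by
  classical
  have hσ' : (0 : ℝ) < σ := hσ
  have hexp : ∀ ω, tiltProd η σ (ε * (ρ / σ ^ 2)) J s ω = ENNReal.ofReal (Real.exp
      ((ρ / σ ^ 2) * (ε * ∑ v ∈ occurrences J s ω, η v ω) -
        (occurrences J s ω).card * (ρ ^ 2 / (2 * σ ^ 2)))) := fun ω => by
    rw [tiltProd, ← Finset.prod_filter]
    unfold tilt
    rw [← ENNReal.ofReal_prod_of_nonneg fun _ _ => (Real.exp_pos _).le, ← Real.exp_sum,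
      Finset.sum_sub_distrib, ← Finset.mul_sum, Finset.sum_const, nsmul_eq_mul, occurrences]
    have : (ε * (ρ / (σ : ℝ) ^ 2)) ^ 2 * (σ : ℝ) ^ 2 / 2 = ρ ^ 2 / (2 * (σ : ℝ) ^ 2) := by
      rw [mul_pow, hε]; field_simp
    rw [this]
    ring_nf
  have hsub : {ω | (occurrences J s ω).card = m ∧
      m * ρ ≤ ε * ∑ v ∈ occurrences J s ω, η v ω} ⊆
      {ω | ENNReal.ofReal (Real.exp (m * ρ ^ 2 / (2 * σ ^ 2))) ≤
        tiltProd η σ (ε * (ρ / σ ^ 2)) J s ω} := by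
    rintro ω ⟨h1, h2⟩
    rw [Set.mem_ofPred_eq, hexp, h1]
    refine ENNReal.ofReal_le_ofReal (Real.exp_le_exp.2 ?_)
    have h3 := mul_le_mul_of_nonneg_left h2 (show 0 ≤ ρ / (σ : ℝ) ^ 2 by positivity)
    have h4 : m * ρ ^ 2 / (2 * (σ : ℝ) ^ 2) =
        ρ / (σ : ℝ) ^ 2 * (m * ρ) - m * (ρ ^ 2 / (2 * (σ : ℝ) ^ 2)) := by
      field_simp; ring
    rw [h4]
    linarith
  have hmeas : Measurable (tiltProd η σ (ε * (ρ / σ ^ 2)) J s) :=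
    measurable_tiltProd σ _ (fun v _ => hη v) (fun v _ => past_le hη v _ (hJ v))
  have hmarkov := mul_meas_ge_le_lintegral (μ := P) hmeas
    (ENNReal.ofReal (Real.exp (m * ρ ^ 2 / (2 * σ ^ 2))))
  rw [lintegral_tiltProd hη hind hlaw hJ] at hmarkov
  refine (measure_mono hsub).trans ?_
  rw [Real.exp_neg, ENNReal.ofReal_inv_of_pos (Real.exp_pos _), ← one_div,
    ENNReal.le_div_iff_mul_le (Or.inl (by simp [Real.exp_pos])) (Or.inl ENNReal.ofReal_ne_top),
    mul_comm]
  exact hmarkov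

theorem measure_abs_le_exp (hσ : 0 < σ) (hη : ∀ s, Measurable (η s)) (hind : iIndepFun η P)
    (hlaw : ∀ s, HasLaw (η s) (gaussianReal 0 (σ ^ 2)) P) {J : ℕ → Set Ω}
    (hJ : ∀ v, MeasurableSet[past η v] (J v)) (s m : ℕ) {ρ : ℝ} (hρ : 0 ≤ ρ) :
    P {ω | (occurrences J s ω).card = m ∧ m * ρ ≤ |∑ v ∈ occurrences J s ω, η v ω|} ≤
      2 * ENNReal.ofReal (Real.exp (-(m * ρ ^ 2 / (2 * σ ^ 2)))) := by
  rw [two_mul]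
  refine le_trans (measure_mono ?_) ((measure_union_le _ _).trans (add_le_add
    (measure_le_exp hσ hη hind hlaw hJ s m ρ 1 (by norm_num) hρ)
    (measure_le_exp hσ hη hind hlaw hJ s m ρ (-1) (by norm_num) hρ)))
  rintro ω ⟨h1, h2⟩
  rcases le_abs.1 h2 with h | h
  · exact Or.inl ⟨h1, by linarith⟩
  · exact Or.inr ⟨h1, by linarith⟩

end Tilt

end LipschitzBandit

/-! ### The clean event -/

namespace LipschitzBandit

variable {X : Type*} {Ω : Type*}

/-- The event that in round `v` the same arm is played as in the earlier round `u`. -/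
def replay (A : Algorithm X) (O : List (X × ℝ) → Option X) (μ : X → ℝ) (η : ℕ → Ω → ℝ)
    (u v : ℕ) : Set Ω :=
  {ω | u ≤ v ∧ A.strategyAt O μ (fun k => η k ω) v = A.strategyAt O μ (fun k => η k ω) u}

/-- Naming an arm by a round `u` in which it is played keeps the union bound finite for any `X`;
requiring `u ≤ v` makes the selection predictable. -/
theorem measurableSet_replay (A : Algorithm X) (O : List (X × ℝ) → Option X) (μ : X → ℝ)
    (N : ℕ → ℕ) (η : ℕ → Ω → ℝ) (u v : ℕ) :
    MeasurableSet[past η v] (replay (A.rounded N) O μ η u v) := by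
  by_cases h : u ≤ v
  · have := @measurableSet_strategyAt_eq X A O μ N Ω (past η v) η v u h
      fun i hi => measurable_past η hi
    simpa [replay, h] using this
  · simp [replay, h]

/-- The event that in the phase starting in round `T` the total noise of some arm exceeds what the
confidence radius allows for. -/
def badEvent (A : Algorithm X) (O : List (X × ℝ) → Option X) (μ : X → ℝ) (η : ℕ → Ω → ℝ)
    (σ : ℝ) (T : ℕ) : Set Ω :=
  ⋃ u ∈ Finset.range (T ^ 2), ⋃ s ∈ Finset.range (T ^ 2), ⋃ m ∈ Finset.Icc 1 (T ^ 2),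
    {ω | (occurrences (replay A O μ η u) s ω).card = m ∧
      m * (radius (confidence σ T) m / 2) ≤
        |∑ v ∈ occurrences (replay A O μ η u) s ω, η v ω|}

/-- Noise is allowed half the radius, so the exponent is `confidence / (8 σ²)`. The constant `40`
makes this at least `5 log T²`. -/
theorem exp_neg_radius_le {σ : NNReal} (hσ : 0 < σ) {T m : ℕ} (hT : 2 ≤ T) (hm : 1 ≤ m) :
    Real.exp (-(m * (radius (confidence σ T) m / 2) ^ 2 / (2 * σ ^ 2))) ≤
      1 / ((T : ℝ) ^ 2) ^ 5 := by
  have hσ' : (0 : ℝ) < σ := hσ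
  have hT' : (2 : ℝ) ≤ T := by exact_mod_cast hT
  have h1 := radius_sq_mul (one_le_confidence σ hT) hm
  have h2 : m * (radius (confidence σ T) m / 2) ^ 2 / (2 * (σ : ℝ) ^ 2) =
      confidence σ T / (8 * σ ^ 2) := by
    conv_rhs => rw [← h1]
    field_simp; ring
  have hlog : 0 ≤ Real.log ((T : ℝ) ^ 2) := Real.log_nonneg (by nlinarith)
  have h3 : 5 * Real.log ((T : ℝ) ^ 2) ≤ confidence σ T / (8 * σ ^ 2) := by
    rw [le_div_iff₀ (by positivity), confidence]
    have : (σ : ℝ) ^ 2 ≤ max 1 (σ : ℝ) ^ 2 := pow_le_pow_left₀ hσ'.le (le_max_right _ _) 2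
    nlinarith [mul_le_mul_of_nonneg_right this hlog]
  rw [h2, one_div, ← Real.exp_log (show (0 : ℝ) < (((T : ℝ) ^ 2) ^ 5)⁻¹ by positivity),
    Real.log_inv, Real.log_pow]
  exact Real.exp_le_exp.2 (by push_cast; linarith)

/-- There are `T ^ 6` triples `(u, s, m)`, each of probability at most `2 / T ^ 10`. -/
theorem measure_badEvent_le [MeasurableSpace Ω] {P : Measure Ω} [IsProbabilityMeasure P]
    {η : ℕ → Ω → ℝ} {σ : NNReal} (hσ : 0 < σ) (hη : ∀ s, Measurable (η s))
    (hind : iIndepFun η P) (hlaw : ∀ s, HasLaw (η s) (gaussianReal 0 (σ ^ 2)) P)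
    (A : Algorithm X) (O : List (X × ℝ) → Option X) (μ : X → ℝ) (N : ℕ → ℕ) {T : ℕ}
    (hT : 2 ≤ T) :
    P.real (badEvent (A.rounded N) O μ η σ T) ≤ 2 / (T : ℝ) ^ 4 := by
  have hT0 : (0 : ℝ) < T := by exact_mod_cast (by omega : 0 < T)
  have key : P (badEvent (A.rounded N) O μ η σ T) ≤
      ∑ _u ∈ Finset.range (T ^ 2), ∑ _s ∈ Finset.range (T ^ 2), ∑ _m ∈ Finset.Icc 1 (T ^ 2),
        2 * ENNReal.ofReal (1 / ((T : ℝ) ^ 2) ^ 5) := by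
    refine (measure_biUnion_finset_le _ _).trans (Finset.sum_le_sum fun u _ => ?_)
    refine (measure_biUnion_finset_le _ _).trans (Finset.sum_le_sum fun s _ => ?_)
    refine (measure_biUnion_finset_le _ _).trans (Finset.sum_le_sum fun m hm => ?_)
    refine (measure_abs_le_exp hσ hη hind hlaw (measurableSet_replay A O μ N η u) s m
      (by unfold radius; positivity)).trans ?_
    gcongr
    exact exp_neg_radius_le hσ hT (Finset.mem_Icc.1 hm).1
  refine ENNReal.toReal_le_of_le_ofReal (by positivity) (key.trans (le_of_eq ?_))
  simp only [Finset.sum_const, Finset.card_range, Nat.card_Icc, add_tsub_cancel_right,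
    nsmul_eq_mul]
  rw [← ENNReal.ofReal_natCast, show (2 : ENNReal) = ENNReal.ofReal 2 by simp,
    ← ENNReal.ofReal_mul (by norm_num), ← ENNReal.ofReal_mul (by positivity),
    ← ENNReal.ofReal_mul (by positivity), ← ENNReal.ofReal_mul (by positivity)]
  congr 1
  push_cast
  field_simp

variable [Nonempty X]

theorem abs_average_sub_le {O : List (X × ℝ) → Option X} {μ : X → ℝ} {η : ℕ → Ω → ℝ} {σ : ℝ}
    {t : ℕ} {ω : Ω} (hω : ω ∉ badEvent (roundedZooming X σ) O μ η σ (phaseStart t))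
    {s v : ℕ} (hs : s ∈ Finset.Ico (phaseStart t) (phaseStart t ^ 2))
    (hv : v ∈ Finset.Ico (phaseStart t) s) :
    |average (roundedZooming X σ) O μ (fun k => η k ω) (phaseStart t) s
        ((roundedZooming X σ).strategyAt O μ (fun k => η k ω) v) -
      μ ((roundedZooming X σ).strategyAt O μ (fun k => η k ω) v)| ≤
    radius (confidence σ (phaseStart t)) (visits
      ((roundedZooming X σ).strategyAt O μ (fun k => η k ω)) (phaseStart t) s
      ((roundedZooming X σ).strategyAt O μ (fun k => η k ω) v)) := by
  classical
  set A := roundedZooming X σ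
  set ξ : ℕ → ℝ := fun k => η k ω with hξ
  set x := A.strategyAt O μ ξ with hx
  have hprec : ∀ w ∈ Finset.Ico (phaseStart t) s, precision w = phaseStart t ^ 2 := by
    intro w hw
    rw [precision, phaseStart_eq_of_mem]
    simp only [Finset.mem_Ico] at hw hs ⊢
    omega
  have hT2 := two_le_phaseStart t
  set T := phaseStart t with hT
  have hsI := Finset.mem_Ico.1 hs
  have hvI := Finset.mem_Ico.1 hv
  have hpos : 0 < visits x T s (x v) := visits_pos.2 ⟨v, hv, rfl⟩
  -- With `u` the first play of the arm in the phase, the replays of `u` before `s` are exactly its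
  -- plays in `[T, s)`.
  obtain ⟨u, hTu, hus, hxu, hmin⟩ : ∃ u, T ≤ u ∧ u < s ∧ x u = x v ∧
      ∀ w, T ≤ w → x w = x v → u ≤ w := by
    have hex : ∃ w, T ≤ w ∧ w < s ∧ x w = x v := ⟨v, hvI.1, hvI.2, rfl⟩
    obtain ⟨h1, h2, h3⟩ := Nat.find_spec hex
    refine ⟨Nat.find hex, h1, h2, h3, fun w hw hxw => ?_⟩
    by_contra hlt
    exact Nat.find_min hex (not_le.1 hlt) ⟨hw, by omega, hxw⟩
  have hocc : occurrences (replay A O μ η u) s ω =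
      (Finset.Ico T s).filter (fun w => x w = x v) := by
    ext w
    simp only [occurrences, replay, Finset.mem_filter, Finset.mem_range, Finset.mem_Ico,
      Set.mem_ofPred_eq, ← hξ, ← hx, hxu]
    constructor
    · rintro ⟨h1, h2, h3⟩
      exact ⟨⟨by omega, h1⟩, h3⟩
    · rintro ⟨⟨h1, h2⟩, h3⟩
      exact ⟨h2, hmin w h1 h3, h3⟩
  set n := visits x T s (x v) with hn
  have hcard : (occurrences (replay A O μ η u) s ω).card = n := by
    rw [hocc, hn, visits]
  have hnH : n ≤ T ^ 2 := by
    rw [hn, visits]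
    refine (Finset.card_filter_le _ _).trans ?_
    rw [Nat.card_Ico]; omega
  have hnoise : |∑ w ∈ (Finset.Ico T s).filter (fun w => x w = x v), ξ w| ≤
      n * (radius (confidence σ T) n / 2) := by
    by_contra hlt
    refine hω ?_
    simp only [badEvent, Set.mem_iUnion, Finset.mem_range, Finset.mem_Icc]
    refine ⟨u, by omega, s, hsI.2, n, ⟨hpos, hnH⟩, hcard, ?_⟩
    rw [hocc]
    exact (not_le.1 hlt).le
  have hn0 : (0 : ℝ) < n := by exact_mod_cast hpos
  have hT2' : (2 : ℝ) ≤ T := by exact_mod_cast hT2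
  have hround : |∑ w ∈ (Finset.Ico T s).filter (fun w => x w = x v),
      (roundTo (precision w) (A.rewardAt O μ ξ w) - A.rewardAt O μ ξ w)| ≤ n * (1 / (T : ℝ) ^ 2) := by
    refine (Finset.abs_sum_le_sum_abs _ _).trans ?_
    have h := Finset.sum_le_card_nsmul ((Finset.Ico T s).filter (fun w => x w = x v))
      (fun w => |roundTo (precision w) (A.rewardAt O μ ξ w) - A.rewardAt O μ ξ w|)
      (1 / (T : ℝ) ^ 2) (fun w hw => by
        have := abs_roundTo_sub_le (N := T ^ 2) (by positivity) (A.rewardAt O μ ξ w)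
        rw [hprec w (Finset.mem_filter.1 hw).1]
        exact_mod_cast this)
    rw [nsmul_eq_mul, ← hocc, hcard] at h
    rwa [← hocc]
  -- The rounding error `1 / T²` fits in the other half of the radius, since `n ≤ T²` forces the
  -- radius to be at least `1 / T ≥ 2 / T²`.
  have hrad : 2 / (T : ℝ) ^ 2 ≤ radius (confidence σ T) n := by
    have h2 := one_le_confidence σ hT2
    have h4 : (n : ℝ) ≤ (T : ℝ) ^ 2 := by exact_mod_cast hnH
    refine Real.le_sqrt_of_sq_le ?_
    rw [le_div_iff₀ hn0, div_pow, div_mul_eq_mul_div, div_le_iff₀ (by positivity)]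
    have h5 : (2 : ℝ) ^ 2 ≤ (T : ℝ) ^ 2 := pow_le_pow_left₀ (by norm_num) hT2' 2
    nlinarith [mul_le_mul h5 h4 hn0.le (by positivity), mul_le_mul_of_nonneg_right h2
      (show (0 : ℝ) ≤ ((T : ℝ) ^ 2) ^ 2 by positivity)]
  have hsum : sumRewards T (x v) (A.roundedHistory O μ ξ precision s) - n * μ (x v) =
      ∑ w ∈ (Finset.Ico T s).filter (fun w => x w = x v),
        (roundTo (precision w) (A.rewardAt O μ ξ w) - A.rewardAt O μ ξ w) +
      ∑ w ∈ (Finset.Ico T s).filter (fun w => x w = x v), ξ w := by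
    rw [sumRewards_roundedHistory, hn, visits, ← nsmul_eq_mul, ← Finset.sum_const,
      ← Finset.sum_sub_distrib, ← Finset.sum_add_distrib]
    refine Finset.sum_congr rfl fun w hw => ?_
    have : A.strategyAt O μ ξ w = x v := (Finset.mem_filter.1 hw).2
    rw [Algorithm.rewardAt, this]
    ring
  have hfin : average A O μ ξ T s (x v) - μ (x v) =
      (sumRewards T (x v) (A.roundedHistory O μ ξ precision s) - n * μ (x v)) / n := by
    rw [average, ← hx, ← hn]
    field_simp
  rw [hfin, abs_div, abs_of_pos hn0, div_le_iff₀ hn0, hsum]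
  refine (abs_add_le _ _).trans ((add_le_add hround hnoise).trans ?_)
  have : 1 / (T : ℝ) ^ 2 = (2 / (T : ℝ) ^ 2) / 2 := by ring
  rw [this]
  nlinarith

end LipschitzBandit

/-! ### From layer counts to total loss -/

namespace LipschitzBandit

section Deterministic

variable {X : Type*} [MetricSpace X] {μ : X → ℝ}

/-- A point of loss `r > 0` lies in the layer `X_r`, so its covering number `C r^{-d}` is at least
one. This replaces the trivial bound `1` in lower-order terms, which would be too weak for small
`C`. -/
theorem gap_le_rpow (hμ : IsPayoff μ) {C d : ℝ} (hC : 0 < C) (hd : 0 ≤ d)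
    (hcov : ∀ r ∈ Set.Ioc (0 : ℝ) 1, CoverableBy (layer μ r) (C * r ^ (-d)) (r / 8)) (z : X) :
    gap μ z ≤ C ^ (1 / (2 + d)) := by
  have h1 := hμ.gap_le_one z
  rcases (hμ.gap_nonneg z).eq_or_lt with h0 | h0
  · rw [← h0]; positivity
  obtain ⟨F, hF, -, hz⟩ := hcov _ ⟨h0, h1⟩
  obtain ⟨S, hS, -⟩ := hz z (mem_layer.2 ⟨by linarith, le_rfl⟩)
  have h2 : (1 : ℝ) ≤ F.card := by exact_mod_cast Finset.card_pos.2 ⟨S, hS⟩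
  have h3 : gap μ z ^ d ≤ C := by
    have h4 := h2.trans hF
    rwa [Real.rpow_neg h0.le, ← div_eq_mul_inv, one_le_div (by positivity)] at h4
  have h5 : gap μ z ^ (2 + d) ≤ C :=
    (Real.rpow_le_rpow_of_exponent_ge h0 h1 (by linarith)).trans h3
  rw [one_div, Real.le_rpow_inv_iff_of_pos h0.le hC.le (by linarith)]
  exact h5

/-- A loss above `Y / 2` belongs to the layer of the first scale `Y * 2 ^ j` that reaches it. Scales
are capped at `1`, beyond which layers are not controlled. -/
theorem gap_le_sum_layers (hμ : IsPayoff μ) {Y : ℝ} (hY : 0 < Y) {J : ℕ} (hJ : 1 ≤ Y * 2 ^ J)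
    (z : X) [∀ j : ℕ, Decidable (z ∈ layer μ (min 1 (Y * 2 ^ j)))] :
    gap μ z ≤ Y / 2 + ∑ j ∈ Finset.range (J + 1),
      if z ∈ layer μ (min 1 (Y * 2 ^ j)) then min 1 (Y * 2 ^ j) else 0 := by
  classical
  have hnn : ∀ j ∈ Finset.range (J + 1),
      0 ≤ if z ∈ layer μ (min 1 (Y * 2 ^ j)) then min 1 (Y * 2 ^ j) else 0 := by
    intro j _
    split_ifs
    · positivity
    · exact le_rfl
  rcases le_or_gt (gap μ z) (Y / 2) with h | h
  · exact h.trans (le_add_of_nonneg_right (Finset.sum_nonneg hnn))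
  have h1 := hμ.gap_le_one z
  have hex : ∃ j, gap μ z ≤ Y * 2 ^ j := ⟨J, h1.trans hJ⟩
  have hle : gap μ z ≤ min 1 (Y * 2 ^ Nat.find hex) := le_min h1 (Nat.find_spec hex)
  have hjJ : Nat.find hex ≤ J := Nat.find_min' hex (h1.trans hJ)
  have hmem : z ∈ layer μ (min 1 (Y * 2 ^ Nat.find hex)) := by
    refine mem_layer.2 ⟨?_, hle⟩
    have hr : min 1 (Y * 2 ^ Nat.find hex) ≤ Y * 2 ^ Nat.find hex := min_le_right _ _
    rcases hj : Nat.find hex with _ | j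
    · rw [hj, pow_zero] at hr
      rw [pow_zero]
      linarith
    · have := not_le.1 (Nat.find_min hex (m := j) (by omega))
      rw [hj, pow_succ] at hr
      rw [pow_succ]
      linarith
  have := Finset.single_le_sum hnn (Finset.mem_range.2 (Nat.lt_succ_of_le hjJ))
  rw [if_pos hmem] at this
  linarith

open Classical in
/-- If every layer `X_r` is visited at most `M r ^ (-(2 + d))` times, then all but
`3 M Y ^ (-(1 + d))` of the total loss is due to rounds with a loss of at most `Y / 2`. -/
theorem sum_gap_le (hμ : IsPayoff μ) (x : ℕ → X) (I : Finset ℕ) {M d Y : ℝ} (hM : 0 ≤ M)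
    (hd : 0 ≤ d) (hY : 0 < Y) (hY1 : Y ≤ 1)
    (hcount : ∀ r ∈ Set.Ioc (0 : ℝ) 1,
      ((I.filter fun v => x v ∈ layer μ r).card : ℝ) ≤ M * r ^ (-(2 + d))) :
    ∑ v ∈ I, gap μ (x v) ≤ I.card * (Y / 2) + 3 * M * Y ^ (-(1 + d)) := by
  have hex : ∃ J : ℕ, 1 ≤ Y * 2 ^ J := by
    obtain ⟨J, hJ⟩ := pow_unbounded_of_one_lt (1 / Y) (one_lt_two : (1 : ℝ) < 2)
    refine ⟨J, ?_⟩
    rw [div_lt_iff₀ hY] at hJ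
    linarith
  set J := Nat.find hex with hJdef
  have hJ : 1 ≤ Y * 2 ^ J := Nat.find_spec hex
  have hmin : ∀ j < J, Y * 2 ^ j < 1 := fun j hj => not_le.1 (Nat.find_min hex hj)
  set ρ : ℕ → ℝ := fun j => min 1 (Y * 2 ^ j) with hρ
  have hρ0 : ∀ j, 0 < ρ j := fun j => by simp only [hρ]; positivity
  have hρ1 : ∀ j, ρ j ≤ 1 := fun j => min_le_left _ _
  have hterm : ∀ j, ρ j * ((I.filter fun v => x v ∈ layer μ (ρ j)).card : ℝ) ≤
      M * ρ j ^ (-(1 + d)) := fun j => by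
    have h1 := mul_le_mul_of_nonneg_left (hcount (ρ j) ⟨hρ0 j, hρ1 j⟩) (hρ0 j).le
    refine h1.trans (le_of_eq ?_)
    rw [show -(1 + d) = 1 + -(2 + d) by ring, Real.rpow_add (hρ0 j), Real.rpow_one]
    ring
  -- Minimality of `J` means that the cap costs at most a factor `2` in scale. The scale `ρ 0 = Y`
  -- contributes `1` and this geometric series `2`, hence the constant `3`.
  have hpow : ∀ j < J, ρ (j + 1) ^ (-(1 + d)) ≤ Y ^ (-(1 + d)) * (1 / 2) ^ j := by
    intro j hj
    have h1 : Y * 2 ^ j ≤ ρ (j + 1) := by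
      refine le_min (hmin j hj).le ?_
      gcongr
      · norm_num
      · omega
    refine (Real.rpow_le_rpow_of_nonpos (by positivity) h1 (by linarith)).trans ?_
    rw [Real.mul_rpow hY.le (by positivity)]
    gcongr
    have h2 : (1 : ℝ) ≤ 2 ^ j := one_le_pow₀ (by norm_num)
    refine (Real.rpow_le_rpow_of_exponent_le h2 (show -(1 + d) ≤ -1 by linarith)).trans ?_
    rw [Real.rpow_neg_one, one_div, inv_pow]
  calc ∑ v ∈ I, gap μ (x v)
      ≤ ∑ v ∈ I, (Y / 2 + ∑ j ∈ Finset.range (J + 1),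
          if x v ∈ layer μ (ρ j) then ρ j else 0) :=
        Finset.sum_le_sum fun v _ => gap_le_sum_layers hμ hY hJ (x v)
    _ = I.card * (Y / 2) + ∑ j ∈ Finset.range (J + 1),
          ρ j * ((I.filter fun v => x v ∈ layer μ (ρ j)).card : ℝ) := by
        rw [Finset.sum_add_distrib, Finset.sum_const, nsmul_eq_mul, Finset.sum_comm]
        congr 1
        refine Finset.sum_congr rfl fun j _ => ?_
        rw [← Finset.sum_filter, Finset.sum_const, nsmul_eq_mul, mul_comm]
    _ ≤ I.card * (Y / 2) + ∑ j ∈ Finset.range (J + 1), M * ρ j ^ (-(1 + d)) := by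
        exact add_le_add le_rfl (Finset.sum_le_sum fun j _ => hterm j)
    _ ≤ I.card * (Y / 2) + 3 * M * Y ^ (-(1 + d)) := by
        gcongr
        rw [← Finset.mul_sum, Finset.sum_range_succ']
        have h0 : ρ 0 = Y := by simp [hρ, hY1]
        have h1 : ∑ j ∈ Finset.range J, ρ (j + 1) ^ (-(1 + d)) ≤ Y ^ (-(1 + d)) * 2 := by
          refine (Finset.sum_le_sum fun j hj => hpow j (Finset.mem_range.1 hj)).trans ?_
          rw [← Finset.mul_sum]
          gcongr
          exact sum_geometric_two_le J
        rw [h0]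
        nlinarith [mul_le_mul_of_nonneg_left h1 hM]

end Deterministic

/-! ### Calibration of the scale `Y` -/

section Numeric

variable {C d s : ℝ} {t : ℕ}

/-- Since `s ≥ 1`, `Y^{2+d}` is at least `s²` times the base of the power; then `3 * 6400 ≤ 10 ^ 6 /
4` suffices. -/
theorem layers_contribution_le (hC : 0 < C) (hd : 0 ≤ d) (hs : 1 ≤ s) (ht : 2 ≤ t) :
    3 * (6400 * s ^ 2 * C * Real.log t) *
      (s * (10 ^ 6 * C * Real.log t / t) ^ (1 / (2 + d))) ^ (-(1 + d)) ≤
    t * (s * (10 ^ 6 * C * Real.log t / t) ^ (1 / (2 + d))) / 4 := by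
  have ht0 : (0 : ℝ) < t := by exact_mod_cast (by omega : 0 < t)
  have hL : 0 < Real.log t := Real.log_pos (by exact_mod_cast ht)
  set Q := 10 ^ 6 * C * Real.log t / t with hQ
  have hQ0 : 0 < Q := by positivity
  set Y := s * Q ^ (1 / (2 + d)) with hY
  have hY0 : 0 < Y := by positivity
  have h1 : s ^ 2 * Q ≤ Y ^ (2 + d) := by
    rw [hY, Real.mul_rpow (by positivity) (by positivity), ← Real.rpow_mul hQ0.le,
      one_div_mul_cancel (by positivity), Real.rpow_one]
    gcongr
    rw [← Real.rpow_natCast s 2]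
    exact Real.rpow_le_rpow_of_exponent_le hs (by push_cast; linarith)
  have h2 : Y = Y ^ (2 + d) * Y ^ (-(1 + d)) := by
    rw [← Real.rpow_add hY0, show 2 + d + -(1 + d) = 1 by ring, Real.rpow_one]
  have h3 : 3 * (6400 * s ^ 2 * C * Real.log t) ≤ t * Y ^ (2 + d) / 4 := by
    have h4 : t * (s ^ 2 * Q) = 10 ^ 6 * (s ^ 2 * C * Real.log t) := by
      rw [hQ]; field_simp
    have h5 := mul_le_mul_of_nonneg_left h1 ht0.le
    have h6 : 0 < s ^ 2 * C * Real.log t := by positivity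
    nlinarith
  calc _ ≤ t * Y ^ (2 + d) / 4 * Y ^ (-(1 + d)) := by gcongr
    _ = t * (Y ^ (2 + d) * Y ^ (-(1 + d))) / 4 := by ring
    _ = t * Y / 4 := by rw [← h2]

theorem remainder_le (hC : 0 < C) (hd : 0 ≤ d) (hs : 1 ≤ s) (ht : 2 ≤ t)
    (hsmall : 10 ^ 6 * Real.log t ≤ t) :
    6 * √t * C ^ (1 / (2 + d)) ≤
      t * (s * (10 ^ 6 * C * Real.log t / t) ^ (1 / (2 + d))) / 4 := by
  have ht0 : (0 : ℝ) < t := by exact_mod_cast (by omega : 0 < t)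
  have hL2 : 1 / 2 ≤ Real.log t := by
    have := Real.log_two_gt_d9
    have := Real.log_le_log (by norm_num) (show (2 : ℝ) ≤ t by exact_mod_cast ht)
    linarith
  have h1 : 10 ^ 6 * C * Real.log t / t = C * (10 ^ 6 * Real.log t / t) := by ring
  set q := 10 ^ 6 * Real.log t / t with hq
  have hq0 : 0 < q := by positivity
  have hq1 : q ≤ 1 := (div_le_one ht0).2 hsmall
  -- The exponent is at most `1 / 2` and `q ≤ 1`.
  have h2 : √q ≤ q ^ (1 / (2 + d)) := by
    rw [Real.sqrt_eq_rpow]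
    exact Real.rpow_le_rpow_of_exponent_ge hq0 hq1 (by gcongr; linarith)
  have h3 : 24 * √t ≤ t * √q := by
    have h4 : √(576 : ℝ) = 24 := by
      rw [show (576 : ℝ) = 24 ^ 2 by norm_num]; exact Real.sqrt_sq (by norm_num)
    have h5 : t * √q = √(t ^ 2 * q) := by
      rw [Real.sqrt_mul (by positivity), Real.sqrt_sq ht0.le]
    rw [h5, ← h4, ← Real.sqrt_mul (by norm_num)]
    refine Real.sqrt_le_sqrt ?_
    have h6 : (t : ℝ) ^ 2 * q = t * (10 ^ 6 * Real.log t) := by rw [hq]; field_simp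
    rw [h6]
    nlinarith
  rw [h1, Real.mul_rpow hC.le hq0.le]
  set c := C ^ (1 / (2 + d)) with hc
  have hc0 : 0 < c := by positivity
  calc 6 * √t * c = (24 * √t) * c / 4 := by ring
    _ ≤ (t * √q) * c / 4 := by gcongr
    _ ≤ (t * q ^ (1 / (2 + d))) * c / 4 := by gcongr
    _ = t * (1 * (c * q ^ (1 / (2 + d)))) / 4 := by ring
    _ ≤ t * (s * (c * q ^ (1 / (2 + d)))) / 4 := by gcongr

theorem mul_rpow_div_eq (hC : 0 < C) (ht : 2 ≤ t) :
    t * (s * (10 ^ 6 * C * Real.log t / t) ^ (1 / (2 + d))) =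
      s * ((10 ^ 6 * C * Real.log t) ^ (1 / (2 + d)) * (t : ℝ) ^ (1 - 1 / (2 + d))) := by
  have ht0 : (0 : ℝ) < t := by exact_mod_cast (by omega : 0 < t)
  have hL : 0 < Real.log t := Real.log_pos (by exact_mod_cast ht)
  rw [Real.div_rpow (by positivity) ht0.le, Real.rpow_sub ht0, Real.rpow_one]
  ring

end Numeric

end LipschitzBandit

/-! ### Expected regret -/

namespace LipschitzBandit

variable {X : Type*} [MetricSpace X] {μ : X → ℝ} {O : List (X × ℝ) → Option X}
  {Ω : Type*} {η : ℕ → Ω → ℝ}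

section Integrals

variable [MeasurableSpace Ω] {P : Measure Ω} {σ : NNReal}

theorem integrable_noise (hlaw : ∀ s, HasLaw (η s) (gaussianReal 0 (σ ^ 2)) P) (s : ℕ) :
    Integrable (η s) P := by
  have h : Integrable id (gaussianReal 0 (σ ^ 2)) :=
    memLp_one_iff_integrable.1 (memLp_id_gaussianReal 1)
  rw [← (hlaw s).map_eq] at h
  exact h.comp_aemeasurable (hlaw s).aemeasurable

theorem integral_noise (hlaw : ∀ s, HasLaw (η s) (gaussianReal 0 (σ ^ 2)) P) (s : ℕ) :
    ∫ ω, η s ω ∂P = 0 := by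
  rw [(hlaw s).integral_eq, integral_id_gaussianReal]

variable [IsProbabilityMeasure P]

theorem integrable_payoff (hμ : IsPayoff μ) (hη : ∀ s, Measurable (η s)) (A : Algorithm X)
    (N : ℕ → ℕ) (s : ℕ) :
    Integrable (fun ω => μ ((A.rounded N).strategyAt O μ (fun k => η k ω) s)) P := by
  refine Integrable.of_bound (measurable_comp_strategyAt A O μ N μ s
    fun i _ => hη i).aestronglyMeasurable 1 (Filter.Eventually.of_forall fun ω => ?_)
  have := hμ.mem_Icc ((A.rounded N).strategyAt O μ (fun k => η k ω) s)
  rw [Real.norm_eq_abs, abs_of_nonneg this.1]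
  exact this.2

theorem integrable_rewardAt (hμ : IsPayoff μ) (hη : ∀ s, Measurable (η s))
    (hlaw : ∀ s, HasLaw (η s) (gaussianReal 0 (σ ^ 2)) P) (A : Algorithm X) (N : ℕ → ℕ) (s : ℕ) :
    Integrable (fun ω => (A.rounded N).rewardAt O μ (fun k => η k ω) s) P :=
  (integrable_payoff hμ hη A N s).add (integrable_noise hlaw s)

theorem integrable_gap (hμ : IsPayoff μ) (hη : ∀ s, Measurable (η s)) (A : Algorithm X)
    (N : ℕ → ℕ) (s : ℕ) :
    Integrable (fun ω => gap μ ((A.rounded N).strategyAt O μ (fun k => η k ω) s)) P :=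
  (integrable_const _).sub (integrable_payoff hμ hη A N s)

theorem regret_eq_integral_sum_gap (hμ : IsPayoff μ) (hη : ∀ s, Measurable (η s))
    (hlaw : ∀ s, HasLaw (η s) (gaussianReal 0 (σ ^ 2)) P) (A : Algorithm X) (N : ℕ → ℕ) (t : ℕ) :
    (A.rounded N).regret O μ P η t =
      ∫ ω, ∑ s ∈ Finset.range t,
        gap μ ((A.rounded N).strategyAt O μ (fun k => η k ω) s) ∂P := by
  unfold Algorithm.regret
  rw [integral_finsetSum _ fun s _ => integrable_rewardAt hμ hη hlaw A N s,
    integral_finsetSum _ fun s _ => integrable_gap hμ hη A N s]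
  have h : ∀ s, ∫ ω, gap μ ((A.rounded N).strategyAt O μ (fun k => η k ω) s) ∂P =
      maxReward μ - ∫ ω, (A.rounded N).rewardAt O μ (fun k => η k ω) s ∂P := fun s => by
    unfold gap Algorithm.rewardAt
    rw [integral_sub (integrable_const _) (integrable_payoff hμ hη A N s),
      integral_add (integrable_payoff hμ hη A N s) (integrable_noise hlaw s),
      integral_noise hlaw]
    simp
  simp only [h, Finset.sum_sub_distrib, Finset.sum_const, Finset.card_range, nsmul_eq_mul]

end Integrals

variable [Nonempty X]

open Classical in
theorem card_layer_le_of_notMem_badEvent (hO : IsCoveringOracle O) (hμ : IsPayoff μ) {σ C d : ℝ}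
    (hcov : ∀ r ∈ Set.Ioc (0 : ℝ) 1, CoverableBy (layer μ r) (C * r ^ (-d)) (r / 8))
    (hC : 0 < C) {t₀ t : ℕ} {ω : Ω} (ht : phaseStart t₀ ≤ t)
    (hω : ω ∉ badEvent (roundedZooming X σ) O μ η σ (phaseStart t₀))
    {r : ℝ} (hr : r ∈ Set.Ioc (0 : ℝ) 1) :
    (((Finset.Ico (phaseStart t₀) (phaseStart t₀ ^ 2)).filter fun v =>
      (roundedZooming X σ).strategyAt O μ (fun k => η k ω) v ∈ layer μ r).card : ℝ) ≤
      3200 * max 1 σ ^ 2 * C * Real.log t * r ^ (-(2 + d)) := by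
  have hT := two_le_phaseStart t₀
  have hT0 : (0 : ℝ) < phaseStart t₀ := by exact_mod_cast (by omega : 0 < phaseStart t₀)
  have h := card_layer_le hμ (one_le_confidence σ hT)
    (fun s hs => zoomingRule_roundedZooming σ hO μ (fun k => η k ω) hs)
    (fun s hs v hv => abs_average_sub_le hω hs hv) hr.1 (hcov r hr)
  refine h.trans ?_
  have h1 : r ^ (-(2 + d)) = r ^ (-d) / r ^ 2 := by
    rw [show -(2 + d) = -d - 2 by ring, Real.rpow_sub hr.1, Real.rpow_two]
  have h2 : Real.log (phaseStart t₀) ≤ Real.log t :=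
    Real.log_le_log hT0 (by exact_mod_cast ht)
  have h3 : 0 ≤ max 1 σ ^ 2 * C * (r ^ (-d) / r ^ 2) := by
    have := Real.rpow_pos_of_pos hr.1 (-d)
    positivity
  rw [h1, confidence, Real.log_pow]
  push_cast
  -- `3200` is `40` from `card_layer_le`, `40` from `confidence` and `2` from `log T²`.
  calc C * r ^ (-d) * (40 * (40 * max 1 σ ^ 2 * (2 * Real.log (phaseStart t₀))) / r ^ 2)
      = 3200 * (max 1 σ ^ 2 * C * (r ^ (-d) / r ^ 2)) * Real.log (phaseStart t₀) := by ring
    _ ≤ 3200 * (max 1 σ ^ 2 * C * (r ^ (-d) / r ^ 2)) * Real.log t := by gcongr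
    _ = _ := by ring

theorem sum_gap_le_of_notMem_badEvent (hO : IsCoveringOracle O) (hμ : IsPayoff μ) {σ C d : ℝ}
    (hC : 0 < C) (hd : 0 ≤ d)
    (hcov : ∀ r ∈ Set.Ioc (0 : ℝ) 1, CoverableBy (layer μ r) (C * r ^ (-d)) (r / 8))
    {t t' : ℕ} {ω : Ω} (ht : 2 ≤ t) (h1 : phaseStart t' ≤ phaseStart t)
    (h2 : phaseStart t ≤ phaseStart t' ^ 2) (h3 : phaseStart t' ^ 2 ≤ 4 * t)
    (hω : ω ∉ badEvent (roundedZooming X σ) O μ η σ (phaseStart t))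
    (hω' : ω ∉ badEvent (roundedZooming X σ) O μ η σ (phaseStart t'))
    {Y : ℝ} (hY : 0 < Y) (hY1 : Y ≤ 1) :
    ∑ v ∈ Finset.range t, gap μ ((roundedZooming X σ).strategyAt O μ (fun k => η k ω) v) ≤
      2 * √t * C ^ (1 / (2 + d)) + t * (Y / 2) +
        3 * (6400 * max 1 σ ^ 2 * C * Real.log t) * Y ^ (-(1 + d)) := by
  classical
  set x := (roundedZooming X σ).strategyAt O μ (fun k => η k ω) with hx
  have hL : 0 ≤ Real.log t := Real.log_natCast_nonneg t
  have hTt := phaseStart_le ht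
  have htT := lt_phaseStart_sq t
  have hcount : ∀ r ∈ Set.Ioc (0 : ℝ) 1,
      (((Finset.Ico (phaseStart t') t).filter fun v => x v ∈ layer μ r).card : ℝ) ≤
        6400 * max 1 σ ^ 2 * C * Real.log t * r ^ (-(2 + d)) := by
    intro r hr
    have ha := card_layer_le_of_notMem_badEvent hO hμ hcov hC hTt hω hr
    have hb := card_layer_le_of_notMem_badEvent hO hμ hcov hC (h1.trans hTt) hω' hr
    -- Two consecutive phases cover `[phaseStart t', t)`; their counts add up, which doubles `3200`.
    have hsub : (Finset.Ico (phaseStart t') t).filter (fun v => x v ∈ layer μ r) ⊆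
        (Finset.Ico (phaseStart t) (phaseStart t ^ 2)).filter (fun v => x v ∈ layer μ r) ∪
        (Finset.Ico (phaseStart t') (phaseStart t' ^ 2)).filter (fun v => x v ∈ layer μ r) := by
      intro v hv
      simp only [Finset.mem_union, Finset.mem_filter, Finset.mem_Ico] at hv ⊢
      rcases le_or_gt (phaseStart t) v with h | h
      · exact Or.inl ⟨⟨h, by omega⟩, hv.2⟩
      · exact Or.inr ⟨⟨hv.1.1, by omega⟩, hv.2⟩
    have hc := (Finset.card_le_card hsub).trans (Finset.card_union_le _ _)
    have hc' : (((Finset.Ico (phaseStart t') t).filter fun v => x v ∈ layer μ r).card : ℝ) ≤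
        ((Finset.Ico (phaseStart t) (phaseStart t ^ 2)).filter
          (fun v => x v ∈ layer μ r)).card +
        ((Finset.Ico (phaseStart t') (phaseStart t' ^ 2)).filter
          (fun v => x v ∈ layer μ r)).card := by exact_mod_cast hc
    refine hc'.trans ((add_le_add ha hb).trans (le_of_eq ?_))
    ring
  have hlate := sum_gap_le hμ x (Finset.Ico (phaseStart t') t) (by positivity) hd hY hY1 hcount
  have hcard : ((Finset.Ico (phaseStart t') t).card : ℝ) ≤ t := by
    rw [Nat.card_Ico]; exact_mod_cast Nat.sub_le _ _
  have hearly : ∑ v ∈ Finset.range (phaseStart t'), gap μ (x v) ≤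
      2 * √t * C ^ (1 / (2 + d)) := by
    refine (Finset.sum_le_card_nsmul _ _ _ fun v _ => gap_le_rpow hμ hC hd hcov (x v)).trans ?_
    rw [nsmul_eq_mul, Finset.card_range]
    gcongr
    have h4 : √(4 : ℝ) = 2 := by
      rw [show (4 : ℝ) = 2 ^ 2 by norm_num]; exact Real.sqrt_sq (by norm_num)
    rw [← h4, ← Real.sqrt_mul (by norm_num)]
    exact Real.le_sqrt_of_sq_le (by exact_mod_cast h3)
  rw [← Finset.sum_range_add_sum_Ico _ (h1.trans hTt)]
  have := mul_le_mul_of_nonneg_right hcard (show 0 ≤ Y / 2 by positivity)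
  linarith

theorem regret_roundedZooming_le [MeasurableSpace Ω] {P : Measure Ω} [IsProbabilityMeasure P]
    {σ : NNReal} (hO : IsCoveringOracle O) (hμ : IsPayoff μ) (hσ : 0 < σ)
    (hη : ∀ s, Measurable (η s)) (hind : iIndepFun η P)
    (hlaw : ∀ s, HasLaw (η s) (gaussianReal 0 (σ ^ 2)) P) {C d : ℝ} (hC : 0 < C) (hd : 0 ≤ d)
    (hcov : ∀ r ∈ Set.Ioc (0 : ℝ) 1, CoverableBy (layer μ r) (C * r ^ (-d)) (r / 8))
    {t : ℕ} (ht : 2 ≤ t) :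
    (roundedZooming X σ).regret O μ P η t ≤
      max 1 (σ : ℝ) * ((10 ^ 6 * C * Real.log t) ^ (1 / (2 + d)) *
        (t : ℝ) ^ (1 - 1 / (2 + d))) := by
  have ht0 : (0 : ℝ) < t := by exact_mod_cast (by omega : 0 < t)
  have hL : 0 < Real.log t := Real.log_pos (by exact_mod_cast ht)
  have hs1 : 1 ≤ max 1 (σ : ℝ) := le_max_left _ _
  rw [← mul_rpow_div_eq hC ht, roundedZooming, regret_eq_integral_sum_gap hμ hη hlaw,
    ← roundedZooming]
  set A := roundedZooming X σ with hA
  set Y := max 1 (σ : ℝ) * (10 ^ 6 * C * Real.log t / t) ^ (1 / (2 + d)) with hY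
  have hY0 : 0 < Y := by positivity
  have hint : Integrable (fun ω => ∑ s ∈ Finset.range t,
      gap μ (A.strategyAt O μ (fun k => η k ω) s)) P :=
    integrable_finsetSum _ fun s _ => integrable_gap hμ hη _ _ s
  have hconst : ∀ c : ℝ, (∀ z, gap μ z ≤ c) → ∀ ω, ∑ s ∈ Finset.range t,
      gap μ (A.strategyAt O μ (fun k => η k ω) s) ≤ t * c := fun c hc ω => by
    refine (Finset.sum_le_card_nsmul _ _ _ fun s _ => hc _).trans ?_
    rw [nsmul_eq_mul, Finset.card_range]
  have htriv : ∀ c ≤ Y, (∀ z, gap μ z ≤ c) → ∫ ω, ∑ s ∈ Finset.range t,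
      gap μ (A.strategyAt O μ (fun k => η k ω) s) ∂P ≤ t * Y := fun c hcY hc => by
    have h := integral_mono hint (integrable_const (t * c)) (hconst c hc)
    simp only [integral_const, probReal_univ, one_smul] at h
    exact h.trans (by gcongr)
  rcases le_or_gt 1 Y with hY1 | hY1
  · exact htriv 1 hY1 hμ.gap_le_one
  have hG := gap_le_rpow hμ hC hd hcov
  -- For such small `t` the scale `Y` already exceeds the uniform bound `C ^ (1 / (2 + d))` on the
  -- loss.
  rcases le_or_gt (t : ℝ) (10 ^ 6 * Real.log t) with hsmall | hsmall
  · refine htriv (C ^ (1 / (2 + d))) ?_ hG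
    have h1 : C ≤ 10 ^ 6 * C * Real.log t / t := by
      rw [le_div_iff₀ ht0]
      nlinarith
    calc C ^ (1 / (2 + d)) ≤ (10 ^ 6 * C * Real.log t / t) ^ (1 / (2 + d)) := by gcongr
      _ ≤ Y := le_mul_of_one_le_left (by positivity) hs1
  obtain ⟨t', h1, h2, h3⟩ := exists_previous_phase ht
  set G := C ^ (1 / (2 + d)) with hGdef
  have hG0 : 0 < G := by positivity
  -- A measurable superset of equal measure makes measurability of the bad events irrelevant.
  set U := toMeasurable P (badEvent A O μ η σ (phaseStart t) ∪
    badEvent A O μ η σ (phaseStart t')) with hU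
  have hUm : MeasurableSet U := measurableSet_toMeasurable _ _
  set B := 2 * √t * G + t * (Y / 2) +
    3 * (6400 * max 1 (σ : ℝ) ^ 2 * C * Real.log t) * Y ^ (-(1 + d)) with hB
  have hB0 : 0 ≤ B := by positivity
  have hpath : ∀ ω, ∑ s ∈ Finset.range t, gap μ (A.strategyAt O μ (fun k => η k ω) s) ≤
      B + U.indicator (fun _ => t * G) ω := by
    intro ω
    by_cases hω : ω ∈ U
    · rw [Set.indicator_of_mem hω]
      linarith [hconst G hG ω]
    · rw [Set.indicator_of_notMem hω, add_zero]
      have hn := fun h => hω (subset_toMeasurable _ _ h)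
      exact sum_gap_le_of_notMem_badEvent hO hμ hC hd hcov ht h1 h2 h3
        (fun h => hn (Or.inl h)) (fun h => hn (Or.inr h)) hY0 hY1.le
  have hmain := integral_mono hint ((integrable_const B).add
    ((integrable_const (t * G)).indicator hUm)) hpath
  have hsum : ∫ ω, (B + U.indicator (fun _ => t * G) ω) ∂P = B + P.real U * (t * G) := by
    rw [integral_add (integrable_const B) ((integrable_const (t * G)).indicator hUm),
      integral_indicator_const _ hUm]
    simp
  have hPU : t * P.real U ≤ 4 := by
    have h4 : P.real U ≤ 2 / (phaseStart t : ℝ) ^ 4 + 2 / (phaseStart t' : ℝ) ^ 4 := by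
      have h5 : P.real U = P.real (badEvent A O μ η σ (phaseStart t) ∪
          badEvent A O μ η σ (phaseStart t')) := by
        rw [measureReal_def, hU, measure_toMeasurable, measureReal_def]
      rw [h5]
      exact (measureReal_union_le _ _).trans (add_le_add
        (measure_badEvent_le hσ hη hind hlaw _ O μ _ (two_le_phaseStart t))
        (measure_badEvent_le hσ hη hind hlaw _ O μ _ (two_le_phaseStart t')))
    -- The fourth power is what the previous phase needs: its start satisfies `T' ^ 4 ≥ T ^ 2 > t`.
    have hbound : ∀ T : ℕ, 2 ≤ T → t ≤ T ^ 4 → t * (2 / (T : ℝ) ^ 4) ≤ 2 := by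
      intro T hT htT
      have hT0 : (0 : ℝ) < T := by exact_mod_cast (by omega : 0 < T)
      have htT' : (t : ℝ) ≤ (T : ℝ) ^ 4 := by exact_mod_cast htT
      rw [mul_div_assoc', div_le_iff₀ (by positivity)]
      linarith
    have h6 := (lt_phaseStart_sq t).le
    have h7 := hbound _ (two_le_phaseStart t)
      (h6.trans (Nat.pow_le_pow_right (by have := two_le_phaseStart t; omega) (by norm_num)))
    have h8 := hbound _ (two_le_phaseStart t') (h6.trans (by
      rw [show 4 = 2 * 2 by rfl, pow_mul]
      exact Nat.pow_le_pow_left h2 2))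
    nlinarith [mul_le_mul_of_nonneg_left h4 ht0.le]
  have hsqrt : 1 ≤ √t := Real.one_le_sqrt.2 (by exact_mod_cast (by omega : 1 ≤ t))
  have hA1 := layers_contribution_le hC hd hs1 ht
  have hA2 := remainder_le hC hd hs1 ht hsmall.le
  rw [← hY] at hA1 hA2
  refine hmain.trans ?_
  simp only [Pi.add_apply]
  rw [hsum]
  -- Budget for `t * Y`: one half for small losses, one quarter for the layers, one quarter for `6 *
  -- √t * G`, made up of `2` for the early rounds and `4` for the bad event.
  have h9 : P.real U * (t * G) ≤ 4 * √t * G := by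
    calc P.real U * (t * G) = (t * P.real U) * G := by ring
      _ ≤ 4 * G := by gcongr
      _ ≤ 4 * √t * G := by nlinarith
  have : t * (Y / 2) = t * Y / 2 := by ring
  linarith

end LipschitzBandit

theorem mainTheorem12 :
    ∃ K : ℝ, 0 < K ∧
      ∀ (X : Type*) [Nonempty X] (σ : NNReal), 0 < σ →
        ∃ A : LipschitzBandit.Algorithm X,
          ∀ [MetricSpace X], (∀ x y : X, dist x y ≤ 1) →
          ∀ O : List (X × ℝ) → Option X, LipschitzBandit.IsCoveringOracle O →
          ∀ μ : X → ℝ, LipschitzBandit.IsPayoff μ →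
          ∀ (Ω : Type*) [MeasurableSpace Ω] (P : Measure Ω) [IsProbabilityMeasure P]
            (η : ℕ → Ω → ℝ), iIndepFun η P →
            (∀ s, HasLaw (η s) (gaussianReal 0 (σ ^ 2)) P) →
            (∀ s, Integrable (fun ω => A.rewardAt O μ (fun k => η k ω) s) P) ∧
            ∀ C d : ℝ, 0 < C → LipschitzBandit.IsZoomingDim μ C d →
              ∀ t : ℕ, 2 ≤ t →
                A.regret O μ P η t ≤
                  max 1 (σ : ℝ) *
                    ((K * C * Real.log t) ^ (1 / (2 + d)) * (t : ℝ) ^ (1 - 1 / (2 + d))) := by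
  refine ⟨10 ^ 6, by norm_num, fun X _ σ hσ => ⟨LipschitzBandit.roundedZooming X σ, ?_⟩⟩
  intro _ _ O hO μ hμ Ω _ P _ η hind hlaw
  -- `HasLaw` gives only a.e. measurable noise, while predictability needs measurable noise; passing
  -- to a modification changes no integral.
  let η' : ℕ → Ω → ℝ := fun s => (hlaw s).aemeasurable.mk (η s)
  have hη' : ∀ s, Measurable (η' s) := fun s => (hlaw s).aemeasurable.measurable_mk
  have hae : ∀ s, η s =ᵐ[P] η' s := fun s => (hlaw s).aemeasurable.ae_eq_mk
  have hind' : iIndepFun η' P := hind.congr hae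
  have hlaw' : ∀ s, HasLaw (η' s) (gaussianReal 0 (σ ^ 2)) P := fun s =>
    (hlaw s).congr (hae s).symm
  have hnoise : ∀ᵐ ω ∂P, (fun k => η' k ω) = fun k => η k ω := by
    filter_upwards [ae_all_iff.2 hae] with ω hω
    exact funext fun k => (hω k).symm
  refine ⟨fun s => ?_, fun C d hC hzoom t ht => ?_⟩
  · refine (LipschitzBandit.integrable_rewardAt (O := O) hμ hη' hlaw'
      (LipschitzBandit.zooming X σ) LipschitzBandit.precision s).congr ?_
    filter_upwards [hnoise] with ω hω
    rw [hω]
    rfl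
  · have h : (LipschitzBandit.roundedZooming X σ).regret O μ P η t =
        (LipschitzBandit.roundedZooming X σ).regret O μ P η' t := by
      unfold LipschitzBandit.Algorithm.regret
      congr 1
      refine integral_congr_ae ?_
      filter_upwards [hnoise] with ω hω
      rw [hω]
    rw [h]
    exact LipschitzBandit.regret_roundedZooming_le hO hμ hσ hη' hind' hlaw' hC hzoom.1.1
      hzoom.1.2 ht
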